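/- Let $\mathfrak g$ be a complex simple Lie algebra, $\mathfrak h$ a Cartan subalgebra, $\Sigma$ a simple system of roots with positive roots $\Pi^+$, $\Theta\subset\Sigma$, and $\langle\Theta\rangle$ the set of roots spanned by $\Theta$. Let $\mathfrak p_\Theta=\mathfrak h\oplus\sum_{\alpha\in\langle\Theta\rangle\setminus\Pi^+}\mathfrak g_\alpha\oplus\sum_{\alpha\in\Pi^+}\mathfrak g_\alpha$ be the standard parabolic subalgebra. Let $G$ be a connected complex Lie group with Lie algebra $\mathfrak g$ (realized as a matrix group), $P_\Theta$ the normalizer of $\mathfrak p_\Theta$ in $G$, $\mathfrak u$ a compact real form of $\mathfrak g$, $U=\exp\mathfrak u$, $K_\Theta=P_\Theta\cap U$ and $\mathfrak k_\Theta=\mathfrak u\cap\mathfrak p_\Theta$. Let $\mathfrak m_\Theta$ be the orthogonal complement of $\mathfrak k_\Theta$ in $\mathfrak u$ for the Killing form $(\cdot,\cdot)$; it is identified with the tangent space at the origin $o=eK_\Theta$ of the generalized flag manifold $\mathbb F_\Theta=U/K_\Theta$, and $A_{\mathfrak m}$ denotes the $\mathfrak m_\Theta$-component of $A\in\mathfrak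 u=\mathfrak k_\Theta\oplus\mathfrak m_\Theta$. Let $\Lambda$ be a $U$-invariant Riemannian metric on $\mathbb F_\Theta$, that is, an $\mathrm{Ad}(K_\Theta)$-equivariant operator on $\mathfrak m_\Theta$ that is symmetric and positive for $-(\cdot,\cdot)$, with scalar product $B_\Lambda(A,B)=-(\Lambda A,B)$ on $\mathfrak m_\Theta$. In what follows $[\cdot,\cdot]$ is the bracket of right-invariant vector fields on $U$, i.e. the opposite of the matrix commutator: $[A,B]=BA-AB$, and $\mathrm{ad}(A)=[A,\cdot]$; as usual $\mathrm{Ad}(g)A=gAg^{-1}$. Let $a>0$, $X\in\mathfrak m_\Theta$, $\gamma(t)=\exp(tX)\cdot o$ for $t\in[0,a]$, let $q:[0,a]\to\mathfrak u$ be continuously differentiable, and put $f(s,t)=\exp(s\,q(t))\cdot\gamma(t)$. Let $E(\gamma)=\int_0^a|\gamma'(t)|_\Lambda^2\,dt$ and $E(s)=\int_0^a\left|\frac{\partial f}{\partial t}(s,t)\right|_\Lambda^2dt$ be the energies, and $$C_s(t)=\sum_{k\ge 0}\frac{1}{(k+1)!}\,\mathrm{ad}(s\,q(t))^k\big(s\,q'(t)\big).$$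 1. For every $s\in\mathbb R$ the integrand of $E(s)$ is integrable on $[0,a]$, and $$E(s)=E(\gamma)+\int_0^a B_\Lambda\Big((\mathrm{Ad}(\exp(-tX))C_s(t))_{\mathfrak m},\ (\mathrm{Ad}(\exp(-tX))C_s(t))_{\mathfrak m}+2X\Big)\,dt.$$ 2. If $X$ is a geodesic vector of $\Lambda$, i.e. if the curve $t\mapsto\exp(tX)\cdot o$, $t\in\mathbb R$, is a geodesic of $(\mathbb F_\Theta,\Lambda)$, then $E$ is differentiable near $0$ and twice differentiable at $0$, and $$E''(0)=2\int_0^a B_\Lambda\big([q(t),q'(t)]_{\mathfrak m},X\big)\,dt+2\int_0^a B_\Lambda\Big((\mathrm{Ad}(\exp(-tX))q'(t))_{\mathfrak m},(\mathrm{Ad}(\exp(-tX))q'(t))_{\mathfrak m}\Big)\,dt.$$ -/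

import Mathlib

open Set Filter Topology MeasureTheory

noncomputable section

attribute [local instance 100] LieRing.ofAssociativeRing

namespace FlagManifold

variable {n : Type*} [Fintype n] [DecidableEq n]

/-- The exponential of a complex matrix, as an invertible matrix. -/
def expGL (A : Matrix n n ℂ) : GL n ℂ where
  val := NormedSpace.exp A
  inv := NormedSpace.exp (-A)
  val_inv := by
    rw [← Matrix.exp_add_of_commute A (-A) (Commute.neg_right (Commute.refl A)), add_neg_cancel,
      NormedSpace.exp_zero]
  inv_val := by
    rw [← Matrix.exp_add_of_commute (-A) A (Commute.neg_left (Commute.refl A)), neg_add_cancel,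
      NormedSpace.exp_zero]

/-- The adjoint action of invertible matrices on matrices, `Ad(g) A = g A g⁻¹`. -/
def Ad (g : GL n ℂ) (A : Matrix n n ℂ) : Matrix n n ℂ :=
  (g : Matrix n n ℂ) * A * ((g⁻¹ : GL n ℂ) : Matrix n n ℂ)

/-- The Lie bracket of *right*-invariant vector fields on a matrix group: the opposite of the
matrix commutator, `[A, B] = B A - A B`. -/
def rightBracket (A B : Matrix n n ℂ) : Matrix n n ℂ := B * A - A * B

/-- The series `T_A = ∑ ad(A) ^ k / (k + 1)! = (exp (ad A) - 1) / ad A`, where `ad A` is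
`rightBracket A`. -/
def expDiff (A B : Matrix n n ℂ) : Matrix n n ℂ :=
  ∑' k : ℕ, (((k + 1).factorial : ℝ)⁻¹) • ((rightBracket A)^[k] B)

/-- The data that define a generalized flag manifold: a complex simple (matrix) Lie algebra `𝔤`,
a Cartan subalgebra `𝔥`, a simple system of roots `base`, a set `Θ` of simple roots, and a compact
real form `𝔲` of `𝔤`. -/
structure Datum (n : Type*) [Fintype n] [DecidableEq n] where
  /-- the complex simple Lie algebra -/
  𝔤 : LieSubalgebra ℂ (Matrix n n ℂ)
  [simple : LieAlgebra.IsSimple ℂ 𝔤]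
  /-- the Cartan subalgebra -/
  𝔥 : LieSubalgebra ℂ 𝔤
  [cartan : 𝔥.IsCartanSubalgebra]
  /-- the simple system of roots -/
  base : (LieAlgebra.IsKilling.rootSystem 𝔥).Base
  /-- the chosen set of simple roots -/
  Θ : Set 𝔥.root
  Θ_subset : Θ ⊆ (base.support : Set 𝔥.root)
  /-- the compact real form: a real Lie subalgebra, with `𝔤 = 𝔲 ⊕ i𝔲`, on which the Killing form
  is negative definite -/
  𝔲 : Submodule ℝ 𝔤
  lie_mem : ∀ A ∈ 𝔲, ∀ B ∈ 𝔲, ⁅A, B⁆ ∈ 𝔲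
  exists_add : ∀ Z : 𝔤, ∃ A ∈ 𝔲, ∃ B ∈ 𝔲, Z = A + Complex.I • B
  eq_zero : ∀ A ∈ 𝔲, Complex.I • A ∈ 𝔲 → A = 0
  killing_neg : ∀ A ∈ 𝔲, A ≠ 0 → (killingForm ℂ 𝔤 A A).re < 0

namespace Datum

attribute [instance] Datum.simple Datum.cartan

variable (D : Datum n)

/-- The root lies in `⟨Θ⟩`, the set of roots spanned by `Θ`. -/
def InSpanΘ (α : D.𝔥.root) : Prop :=
  (LieAlgebra.IsKilling.rootSystem D.𝔥).root α ∈
    AddSubgroup.closure ((LieAlgebra.IsKilling.rootSystem D.𝔥).root '' D.Θ)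

/-- The standard parabolic subalgebra `𝔭_Θ`: the sum of the Cartan subalgebra, the root spaces of
the negative roots in `⟨Θ⟩`, and the root spaces of all positive roots. -/
def 𝔭 : Submodule ℂ D.𝔤 :=
  D.𝔥.toSubmodule ⊔
    (⨆ α : {α : D.𝔥.root // D.InSpanΘ α ∧ ¬ D.base.IsPos α},
      (LieAlgebra.rootSpace D.𝔥 (α.1.1 : D.𝔥 → ℂ)).toSubmodule) ⊔
    (⨆ α : {α : D.𝔥.root // D.base.IsPos α},
      (LieAlgebra.rootSpace D.𝔥 (α.1.1 : D.𝔥 → ℂ)).toSubmodule)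

/-- `𝔨_Θ = 𝔲 ∩ 𝔭_Θ`. -/
def 𝔨 : Submodule ℝ D.𝔤 := D.𝔲 ⊓ D.𝔭.restrictScalars ℝ

/-- `𝔪_Θ`, the orthogonal complement of `𝔨_Θ` in `𝔲` with respect to the Killing form. -/
def 𝔪 : Submodule ℝ D.𝔤 where
  carrier := {A | A ∈ D.𝔲 ∧ ∀ B ∈ D.𝔨, killingForm ℂ D.𝔤 A B = 0}
  zero_mem' := ⟨D.𝔲.zero_mem, fun B _ => by simp⟩
  add_mem' := fun {A A'} h h' => ⟨D.𝔲.add_mem h.1 h'.1, fun B hB => by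
    rw [map_add, LinearMap.add_apply, h.2 B hB, h'.2 B hB, add_zero]⟩
  smul_mem' := fun r A h => ⟨D.𝔲.smul_mem r h.1, fun B hB => by
    have hr : r • A = (r : ℂ) • A := by
      apply Subtype.ext
      ext i j
      simp
    rw [hr, map_smul, LinearMap.smul_apply, h.2 B hB, smul_zero]⟩

/-- Elements of the real subspaces of `𝔤`, as matrices. -/
abbrev mat {D : Datum n} {V : Submodule ℝ D.𝔤} (A : V) : Matrix n n ℂ := ((A : D.𝔤) : Matrix n n ℂ)

/-- The inclusion of `𝔪_Θ` in `𝔲`. -/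
def toU {D : Datum n} (A : D.𝔪) : D.𝔲 := ⟨A.1, A.2.1⟩

/-- The connected group `G` with Lie algebra `𝔤`, generated by the exponentials. -/
def G : Subgroup (GL n ℂ) := Subgroup.closure {g | ∃ A : D.𝔤, g = expGL (A : Matrix n n ℂ)}

/-- `P_Θ`, the normalizer of `𝔭_Θ` in `G`. -/
def P : Subgroup (GL n ℂ) where
  carrier := {g | g ∈ D.G ∧ ∀ A : Matrix n n ℂ,
    (A ∈ D.𝔭.map D.𝔤.toSubmodule.subtype ↔ Ad g A ∈ D.𝔭.map D.𝔤.toSubmodule.subtype)}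
  one_mem' := ⟨D.G.one_mem, fun A => by simp [Ad]⟩
  mul_mem' := fun {g h} hg hh => ⟨D.G.mul_mem hg.1 hh.1, fun A => by
    rw [hh.2 A, hg.2 (Ad h A)]
    simp only [Ad, mul_inv_rev, Units.val_mul, mul_assoc]⟩
  inv_mem' := fun {g} hg => ⟨D.G.inv_mem hg.1, fun A => by
    rw [hg.2 (Ad g⁻¹ A)]
    simp only [Ad, inv_inv, mul_assoc, Units.mul_inv_cancel_left, Units.mul_inv, mul_one]⟩

/-- The compact group `U = exp 𝔲`, as the group generated by the exponentials. -/
def U : Subgroup (GL n ℂ) := Subgroup.closure {g | ∃ A : D.𝔲, g = expGL (mat A)}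

/-- `K_Θ = P_Θ ∩ U`, as a subgroup of `U`. -/
def K : Subgroup D.U := D.P.subgroupOf D.U

/-- The generalized flag manifold `U / K_Θ`. -/
abbrev Flag : Type _ := D.U ⧸ D.K

/-- The origin `o = e K_Θ`. -/
def origin : D.Flag := QuotientGroup.mk 1

/-- The exponential map `𝔲 → U`. -/
def expU {D : Datum n} (A : D.𝔲) : D.U := ⟨expGL (mat A), Subgroup.subset_closure ⟨A, rfl⟩⟩

/-- The `𝔪_Θ`-component of an element of `𝔲 = 𝔨_Θ ⊕ 𝔪_Θ` (and `0` outside `𝔲`). -/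
def mPart (A : Matrix n n ℂ) : D.𝔪 :=
  open Classical in
  if h : ∃ M : D.𝔪, ∃ N : D.𝔨, A = mat N + mat M then h.choose else 0

/-- An invariant metric, given by an `Ad(K_Θ)`-equivariant operator on `𝔪_Θ`, symmetric and
positive with respect to the negative of the Killing form. -/
structure InvariantMetric where
  /-- the operator -/
  op : D.𝔪 →ₗ[ℝ] D.𝔪
  symm : ∀ A B : D.𝔪, killingForm ℂ D.𝔤 (op A) B = killingForm ℂ D.𝔤 A (op B)
  pos : ∀ A : D.𝔪, A ≠ 0 → 0 < -(killingForm ℂ D.𝔤 (op A) A).re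
  equivariant : ∀ k ∈ D.K, ∀ A B : D.𝔪, Ad (k : GL n ℂ) (mat A) = mat B →
    Ad (k : GL n ℂ) (mat (op A)) = mat (op B)

variable {D}

/-- The scalar product `B_Λ(A, B) = -(Λ A, B)` on `𝔪_Θ`. -/
def InvariantMetric.B (Λ : D.InvariantMetric) (A B : D.𝔪) : ℝ :=
  -(killingForm ℂ D.𝔤 (Λ.op A) B).re

/-- The curve `c` in `U / K_Θ` is differentiable at `t` within `S`, with velocity the image of
`A ∈ 𝔪_Θ ≅ T_o (U / K_Θ)` under the differential at `o` of the translation by `u`: near `t` it has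
a lift `g` to `U` with `g t = u`, differentiable at `t`, with `g(t)⁻¹ g'(t) ∈ 𝔲` having
`𝔪_Θ`-component `A`. -/
def HasVelocity (c : ℝ → D.Flag) (S : Set ℝ) (t : ℝ) (u : D.U) (A : D.𝔪) : Prop :=
  ∃ (g : ℝ → D.U) (Z : D.𝔲),
    (∀ᶠ r in 𝓝[S] t, (QuotientGroup.mk (g r) : D.Flag) = c r) ∧
    g t = u ∧
    HasDerivWithinAt (fun r => ((g r : GL n ℂ) : Matrix n n ℂ))
      (((u : GL n ℂ) : Matrix n n ℂ) * mat Z) S t ∧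
    D.mPart (mat Z) = A

/-- The squared length `|c'(t)|²` for the invariant metric `Λ` (the derivative being taken
within `S`); since the translations by elements of `U` are isometries, it is `B_Λ(A, A)` for a
velocity represented by `A`. The value is `0` where `c` is not differentiable. -/
def speedSq (Λ : D.InvariantMetric) (c : ℝ → D.Flag) (S : Set ℝ) (t : ℝ) : ℝ :=
  open Classical in
  if h : ∃ A : D.𝔪, ∃ u : D.U, HasVelocity c S t u A then Λ.B h.choose h.choose else 0

/-- The energy `∫₀ᵃ |c'(t)|² dt` of a curve on `[0, a]`. -/
def energy (Λ : D.InvariantMetric) (a : ℝ) (c : ℝ → D.Flag) : ℝ :=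
  ∫ t in (0 : ℝ)..a, speedSq Λ c (Icc 0 a) t

/-- The exponential chart of `U / K_Θ` at `u · o`: near `0 ∈ 𝔪_Θ`, the parametrization
`x ↦ u exp(x) · o`. -/
def chart (u : D.U) (x : D.𝔪) : D.Flag := (u * expU (toU x)) • D.origin

/-- The quadratic form of the Riemannian metric at the point `x` of the chart at `u · o`. -/
def chartQuad (Λ : D.InvariantMetric) (u : D.U) (x y : D.𝔪) : ℝ :=
  speedSq Λ (fun r => chart u (x + r • y)) univ 0

/-- The Riemannian metric at the point `x` of the chart at `u · o` (by polarization). -/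
def chartMetric (Λ : D.InvariantMetric) (u : D.U) (x y z : D.𝔪) : ℝ :=
  (chartQuad Λ u x (y + z) - chartQuad Λ u x y - chartQuad Λ u x z) / 2

/-- Near `t₀`, the curve `c` is represented in the exponential chart at `u · o = c t₀` by the
twice differentiable curve `x`, with `x t₀ = 0`, `x' = v` and `v'(t₀) = w`. -/
structure IsChartRep (c : ℝ → D.Flag) (t₀ : ℝ) (u : D.U) (x v : ℝ → D.𝔪) (w : D.𝔪) : Prop where
  zero : x t₀ = 0
  eq : ∀ᶠ t in 𝓝 t₀, c t = chart u (x t)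
  deriv₁ : ∀ᶠ t in 𝓝 t₀, HasDerivAt (fun r => mat (x r)) (mat (v t)) t
  deriv₂ : HasDerivAt (fun r => mat (v r)) (mat w) t₀

/-- Geodesics of the invariant metric `Λ`: twice differentiable curves that satisfy the geodesic
equation of the Levi-Civita connection. Evaluated at the centre of the exponential chart at
`c t₀`, with `h` the metric in that chart, and paired with a vector `z`, the equation is
`h(x'', z) + (∂_{x'} h)(x', z) - (∂_z h)(x', x') / 2 = 0`
(the last two terms are the Christoffel symbol of the first kind). -/
def IsGeodesic (Λ : D.InvariantMetric) (c : ℝ → D.Flag) : Prop :=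
  ∀ t₀ : ℝ,
    (∃ u x v w, IsChartRep c t₀ u x v w) ∧
    ∀ u x v w, IsChartRep c t₀ u x v w → ∀ z : D.𝔪,
      chartMetric Λ u 0 w z
        + deriv (fun r : ℝ => chartMetric Λ u (r • v t₀) (v t₀) z) 0
        - deriv (fun r : ℝ => chartMetric Λ u (r • z) (v t₀) (v t₀)) 0 / 2 = 0

/-- The curve `γ(t) = exp(tX) · o`. -/
def orbitCurve (X : D.𝔪) (t : ℝ) : D.Flag := expU (t • toU X) • D.origin

/-- `X ∈ 𝔪_Θ` is a geodesic vector of `Λ`: the curve `exp(tX) · o` is a geodesic. -/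
def IsGeodesicVector (Λ : D.InvariantMetric) (X : D.𝔪) : Prop := IsGeodesic Λ (orbitCurve X)

/-- The variation `f(s, t) = exp(s q(t)) · γ(t)` of `γ(t) = exp(tX) · o`. -/
def variation (X : D.𝔪) (q : ℝ → D.𝔲) (s t : ℝ) : D.Flag := expU (s • q t) • orbitCurve X t

/-- `(Ad(exp(-tX)) A)_𝔪`. -/
def adPart (X : D.𝔪) (t : ℝ) (A : Matrix n n ℂ) : D.𝔪 :=
  D.mPart (Ad (expU (-(t • toU X)) : GL n ℂ) A)

end Datum

end FlagManifold

end

noncomputable section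

attribute [local instance 100] LieRing.ofAssociativeRing

namespace FlagManifold

/-! ### Differential of the exponential in a real Banach algebra. -/

section BanachAlgebra

set_option linter.unusedSectionVars false

variable {𝔸 : Type*} [NormedRing 𝔸] [NormedAlgebra ℝ 𝔸] [CompleteSpace 𝔸]

open NormedSpace

/-! The curve `t ↦ f(s,t)` lifts to `U` as `g(t) = exp(s q(t)) exp(tX)`. Multiplying the derivative
of `exp` at `A` in the direction `B` by `exp(-A)` on the left gives `dexp A B = ∫₀¹ exp(-τA) B
exp(τA) dτ`, which is the series `∑ ad(A)ᵏ B / (k+1)!` for the opposite bracket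
(`HasDerivWithinAt.exp_dexp`, `hasSum_dexp`). Hence `g⁻¹g' = V_s + X` with `V_s(t) = Ad(exp(-tX))
C_s(t)`. Taking `𝔪`-components, the squared speed is `B_Λ(X,X) + B_Λ(V_s, V_s + 2X)`, and
integration gives the energy formula.

This needs the speed to be independent of the lift (`HasVelocity.B_eq`). Two lifts differ by a curve
in `K_Θ`, whose velocity must be shown to lie in `𝔨_Θ`. Since `P_Θ` is given only as a normalizer,
the point is that `𝔭_Θ` is its own normalizer in `𝔤`, which is read off from its weights.

For the second variation, `dexp (sA) (sB) = ∫₀ˢ exp(-τA) B exp(τA) dτ`, so `∂_s V_s = Ad(exp(-tX))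
(exp(-sq) q' exp(sq))`, and one more derivative at `s = 0` gives `Ad(exp(-tX)) [q,q']`. As `V_0 =
0`, `E''(0)` is twice the integral of `B_Λ(Ad(exp(-tX)) [q,q'], X) + B_Λ(∂_s V, ∂_s V)`. The
geodesic hypothesis removes `Ad(exp(-tX))` from the first term: the geodesic equation at `o` yields
`B_Λ([X,Z],X) = 0` for `Z ∈ 𝔪`, invariance under `Ad(K_Θ)` yields it for `Z ∈ 𝔨`, and therefore `t ↦
B_Λ(Ad(exp(-tX)) Y, X)` is constant (`IsGeodesicVector.form_conjExp`). -/

theorem continuous_exp_real : Continuous (exp : 𝔸 → 𝔸) := by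
  let _ : NormedAlgebra ℚ 𝔸 := .restrictScalars ℚ ℝ 𝔸
  exact exp_continuous

theorem exp_neg_mul_exp (A : 𝔸) : exp (-A) * exp A = 1 := by
  let _ : NormedAlgebra ℚ 𝔸 := .restrictScalars ℚ ℝ 𝔸
  rw [← exp_add_of_commute (Commute.neg_left (Commute.refl A)), neg_add_cancel, exp_zero]

theorem exp_mul_exp_neg (A : 𝔸) : exp A * exp (-A) = 1 := by
  simpa using exp_neg_mul_exp (-A)

theorem exp_smul_add (s t : ℝ) (A : 𝔸) : exp ((s + t) • A) = exp (s • A) * exp (t • A) := by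
  let _ : NormedAlgebra ℚ 𝔸 := .restrictScalars ℚ ℝ 𝔸
  rw [add_smul, exp_add_of_commute (((Commute.refl A).smul_left s).smul_right t)]

/-- `exp(-A) B exp(A)`. -/
def conjExp (A B : 𝔸) : 𝔸 := exp (-A) * B * exp A

/-- The opposite commutator in an associative ring. -/
def oppBracket (A B : 𝔸) : 𝔸 := B * A - A * B

theorem continuous_conjExp : Continuous fun p : 𝔸 × 𝔸 => conjExp p.1 p.2 := by
  have := continuous_exp_real (𝔸 := 𝔸)
  unfold conjExp
  fun_prop

theorem hasDerivAt_conjExp_smul (A B : 𝔸) (t : ℝ) :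
    HasDerivAt (fun τ : ℝ => conjExp (τ • A) B) (conjExp (t • A) (oppBracket A B)) t := by
  have h1 : HasDerivAt (fun τ : ℝ => exp (-(τ • A))) (-(exp (-(t • A)) * A)) t := by
    simpa using hasDerivAt_exp_smul_const (𝕂 := ℝ) (-A) t
  have h2 := hasDerivAt_exp_smul_const' (𝕂 := ℝ) A t
  refine ((h1.mul_const B).mul h2).congr_deriv ?_
  simp only [conjExp, oppBracket]
  noncomm_ring

theorem conjExp_oppBracket (A B : 𝔸) (s : ℝ) :
    conjExp (s • A) (oppBracket A B) = oppBracket A (conjExp (s • A) B) := by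
  have h1 : Commute A (exp (s • A)) := ((Commute.refl A).smul_right s).exp_right
  have h2 : Commute A (exp (-(s • A))) := ((Commute.refl A).smul_right s).neg_right.exp_right
  simp only [conjExp, oppBracket, mul_sub, sub_mul]
  rw [mul_assoc _ (exp (s • A)) A, ← h1.eq, ← mul_assoc A, ← mul_assoc A, h2.eq]
  simp only [mul_assoc]

/-- `oppBracket A` as a continuous linear map. -/
def oppBracketL (A : 𝔸) : 𝔸 →L[ℝ] 𝔸 :=
  (ContinuousLinearMap.mul ℝ 𝔸).flip A - ContinuousLinearMap.mul ℝ 𝔸 A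

@[simp] theorem oppBracketL_apply (A B : 𝔸) : oppBracketL A B = oppBracket A B := by
  simp [oppBracketL, oppBracket]

theorem oppBracketL_pow_apply (A B : 𝔸) (k : ℕ) :
    (oppBracketL A ^ k) B = (oppBracket A)^[k] B := by
  induction k with
  | zero => simp
  | succ k ih => rw [pow_succ', mul_apply_eq_comp, ih, oppBracketL_apply,
      Function.iterate_succ_apply']

theorem oppBracketL_smul_pow_apply (A B : 𝔸) (t : ℝ) (k : ℕ) :
    ((t • oppBracketL A) ^ k) B = t ^ k • (oppBracket A)^[k] B := by
  induction k with
  | zero => simp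
  | succ k ih => rw [pow_succ', mul_apply_eq_comp, ih, smul_apply, map_smul, oppBracketL_apply,
      Function.iterate_succ_apply', smul_smul, pow_succ']

/-- Conjugating the right side back by `exp(-τA)` gives a curve with zero derivative, equal to `B`
at `τ = 0`. This turns conjugation into a power series in `ad A`. -/
theorem conjExp_smul_eq (A B : 𝔸) (t : ℝ) : conjExp (t • A) B = exp (t • oppBracketL A) B := by
  have key : ∀ τ : ℝ, HasDerivAt
      (fun τ : ℝ => conjExp (τ • -A) (exp (τ • oppBracketL A) B)) 0 τ := by
    intro τ
    have h0 := (hasDerivAt_exp_smul_const' (𝕂 := ℝ) (oppBracketL A) τ).clm_apply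
      (hasDerivAt_const τ B)
    have h1 : HasDerivAt (fun τ : ℝ => exp (-(τ • -A))) (exp (τ • A) * A) τ := by
      simpa using hasDerivAt_exp_smul_const (𝕂 := ℝ) A τ
    have h2 := hasDerivAt_exp_smul_const' (𝕂 := ℝ) (-A) τ
    refine ((h1.mul h0).mul h2).congr_deriv ?_
    simp [oppBracket]
    noncomm_ring
  have hc : conjExp (t • -A) (exp (t • oppBracketL A) B) = B := by
    have := is_const_of_deriv_eq_zero (fun τ => (key τ).differentiableAt)
      (fun τ => (key τ).deriv) t 0
    have h0 : (0 : ℝ) • oppBracketL A = 0 := by ext; simp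
    rw [h0, exp_zero, zero_smul] at this
    simpa [conjExp] using this
  conv_lhs => rw [← hc]
  simp only [conjExp, smul_neg, neg_neg, mul_assoc, exp_neg_mul_exp]
  rw [← mul_assoc, exp_neg_mul_exp]
  simp

theorem hasSum_conjExp (A B : 𝔸) (t : ℝ) :
    HasSum (fun k : ℕ => (t ^ k * ((k.factorial : ℝ)⁻¹)) • ((oppBracket A)^[k] B))
      (conjExp (t • A) B) := by
  rw [conjExp_smul_eq]
  have h := NormedSpace.exp_series_hasSum_exp' (𝕂 := ℝ) (t • oppBracketL A)
  have h' := h.mapL (ContinuousLinearMap.apply ℝ 𝔸 B)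
  convert! h' using 2 with k
  rw [ContinuousLinearMap.apply_apply, smul_apply, oppBracketL_smul_pow_apply, smul_smul, mul_comm]

/-- The right logarithmic derivative of the exponential,
`∫₀¹ exp(-τA) B exp(τA) dτ = ∑ ad(A)ᵏ B / (k + 1)!`. -/
def dexp (A B : 𝔸) : 𝔸 := ∫ τ in (0 : ℝ)..1, conjExp (τ • A) B

theorem continuous_dexp : Continuous fun p : 𝔸 × 𝔸 => dexp p.1 p.2 := by
  unfold dexp
  apply intervalIntegral.continuous_parametric_intervalIntegral_of_continuous'
  have : Continuous fun x : (𝔸 × 𝔸) × ℝ => (x.2 • x.1.1, x.1.2) := by fun_prop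
  exact continuous_conjExp.comp this

theorem continuous_conjExp_smul (A B : 𝔸) : Continuous fun τ : ℝ => conjExp (τ • A) B :=
  continuous_iff_continuousAt.2 fun t => (hasDerivAt_conjExp_smul A B t).continuousAt

theorem hasSum_dexp (A B : 𝔸) :
    HasSum (fun k : ℕ => (((k + 1).factorial : ℝ)⁻¹) • ((oppBracket A)^[k] B)) (dexp A B) := by
  have hs : Summable fun k : ℕ => ‖((k.factorial : ℝ)⁻¹) • ((oppBracket A)^[k] B)‖ := by
    have h := NormedSpace.norm_expSeries_summable' (𝕂 := ℝ) (oppBracketL A)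
    refine Summable.of_nonneg_of_le (fun _ => norm_nonneg _) (fun k => ?_) (h.mul_right ‖B‖)
    rw [← oppBracketL_pow_apply, ← smul_apply]
    exact ContinuousLinearMap.le_opNorm _ _
  -- Termwise integration: `∫₀¹ τᵏ/k! dτ = 1/(k+1)!`, each term being dominated on `[0,1]` by its
  -- norm at `τ = 1`.
  have h := intervalIntegral.hasSum_integral_of_dominated_convergence
    (a := 0) (b := 1) (μ := volume) (f := fun τ => conjExp (τ • A) B)
    (F := fun (k : ℕ) (t : ℝ) => (t ^ k * ((k.factorial : ℝ)⁻¹)) • ((oppBracket A)^[k] B))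
    (fun k _ => ‖((k.factorial : ℝ)⁻¹) • ((oppBracket A)^[k] B)‖)
    (fun k => (by fun_prop : Continuous _).aestronglyMeasurable)
    (fun k => ae_of_all _ fun t ht => ?_) (ae_of_all _ fun t _ => hs)
    (by simp) (ae_of_all _ fun t _ => hasSum_conjExp A B t)
  · convert! h using 2 with k
    rw [intervalIntegral.integral_smul_const, intervalIntegral.integral_mul_const, integral_pow,
      Nat.factorial_succ]
    congr 1
    push_cast
    field_simp
    simp
  · rw [mul_smul, norm_smul]
    refine mul_le_of_le_one_left (norm_nonneg _) ?_
    rw [uIoc_of_le zero_le_one] at ht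
    rw [norm_pow, Real.norm_of_nonneg ht.1.le]
    exact pow_le_one₀ ht.1.le ht.2

theorem smul_dexp_smul (A B : 𝔸) (s : ℝ) :
    s • dexp (s • A) B = ∫ τ in (0 : ℝ)..s, conjExp (τ • A) B := by
  have := intervalIntegral.smul_integral_comp_mul_right (a := 0) (b := 1)
    (fun τ : ℝ => conjExp (τ • A) B) s
  simpa [dexp, smul_smul] using this

theorem dexp_smul_right (A B : 𝔸) (s : ℝ) : dexp A (s • B) = s • dexp A B := by
  simp [dexp, conjExp, intervalIntegral.integral_smul]

theorem dexp_add_right (A B C : 𝔸) : dexp A (B + C) = dexp A B + dexp A C := by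
  rw [dexp, dexp, dexp, ← intervalIntegral.integral_add
    ((continuous_conjExp_smul A B).intervalIntegrable _ _)
    ((continuous_conjExp_smul A C).intervalIntegrable _ _)]
  simp only [conjExp, mul_add, add_mul]

/-- Scaling both arguments turns `dexp` into an integral with upper limit `s`, so the fundamental
theorem of calculus applies and the series need not be differentiated. -/
theorem hasDerivAt_dexp_smul_smul (A B : 𝔸) (s : ℝ) :
    HasDerivAt (fun s : ℝ => dexp (s • A) (s • B)) (conjExp (s • A) B) s := by
  simp_rw [dexp_smul_right, smul_dexp_smul]
  have h := continuous_conjExp_smul A B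
  exact intervalIntegral.integral_hasDerivAt_right (h.intervalIntegrable _ _)
    (h.stronglyMeasurableAtFilter _ _) h.continuousAt

theorem dexp_smul_self (A : 𝔸) (r : ℝ) : dexp (r • A) A = A := by
  have h : ∀ τ : ℝ, conjExp (τ • (r • A)) A = A := by
    intro τ
    have h1 : Commute A (exp (τ • r • A)) :=
      (((Commute.refl A).smul_right r).smul_right τ).exp_right
    rw [conjExp, mul_assoc, h1.eq, ← mul_assoc, exp_neg_mul_exp, one_mul]
  simp [dexp, h]

@[simp] theorem dexp_zero_left (B : 𝔸) : dexp 0 B = B := by simp [dexp, conjExp]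

theorem mul_exp_mul_conjExp_add (E A B X : 𝔸) :
    E * exp A * (conjExp A B + X) = E * B * exp A + E * (exp A * X) := by
  rw [mul_add, conjExp, mul_assoc E, mul_assoc (exp (-A)), ← mul_assoc (exp A), exp_mul_exp_neg,
    one_mul]
  simp only [mul_assoc]

/-- Differentiation of a parametric integral with continuous partial derivative. -/
theorem hasDerivAt_integral_of_continuous {E : Type*} [NormedAddCommGroup E] [NormedSpace ℝ E]
    {F F' : ℝ → ℝ → E} {a b : ℝ} (hF : ∀ s, Continuous (F s))
    (hF' : Continuous (Function.uncurry F')) (h : ∀ s t, HasDerivAt (fun s => F s t) (F' s t) s)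
    (s₀ : ℝ) :
    HasDerivAt (fun s => ∫ t in a..b, F s t) (∫ t in a..b, F' s₀ t) s₀ := by
  have hK : IsCompact (Icc (s₀ - 1) (s₀ + 1) ×ˢ uIcc a b) := isCompact_Icc.prod isCompact_uIcc
  obtain ⟨C, hC⟩ := hK.exists_bound_of_continuousOn hF'.continuousOn
  refine (intervalIntegral.hasDerivAt_integral_of_dominated_loc_of_deriv_le
    (s := Icc (s₀ - 1) (s₀ + 1)) (bound := fun _ => C)
    (Icc_mem_nhds (by linarith) (by linarith)) ?_ ((hF s₀).intervalIntegrable _ _) ?_ ?_ ?_ ?_).2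
  · exact Eventually.of_forall fun s => (hF s).aestronglyMeasurable
  · exact (hF'.comp (by fun_prop : Continuous fun t : ℝ => (s₀, t))).aestronglyMeasurable
  · exact ae_of_all _ fun t ht s hs => hC (s, t) ⟨hs, uIoc_subset_uIcc ht⟩
  · simp
  · exact ae_of_all _ fun t _ s _ => h s t

/-- The factor `1/2` is `∫₀¹ τ dτ`; it is the first-order term of the metric in exponential charts.
-/
theorem hasDerivAt_dexp_smul_zero (A B : 𝔸) :
    HasDerivAt (fun r : ℝ => dexp (r • A) B) ((2⁻¹ : ℝ) • oppBracket A B) 0 := by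
  have h := hasDerivAt_integral_of_continuous (a := 0) (b := 1)
    (F := fun r τ => conjExp (τ • (r • A)) B)
    (F' := fun r τ => τ • conjExp (τ • (r • A)) (oppBracket A B)) ?_ ?_ ?_ 0
  · refine h.congr_deriv ?_
    simp [conjExp, intervalIntegral.integral_smul_const]
  · intro r
    exact continuous_conjExp_smul _ _
  · have : Continuous fun x : ℝ × ℝ => (x.2 • (x.1 • A), oppBracket A B) := by fun_prop
    exact continuous_snd.smul (continuous_conjExp.comp this)
  · intro r τ
    have h1 := (hasDerivAt_conjExp_smul A B (τ * r)).scomp r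
      ((hasDerivAt_id r).const_mul τ)
    simpa [Function.comp_def, smul_smul] using h1

/-- Duhamel's formula: integrate the derivative of `exp((1-τ)X) exp(τY)`, which runs from `exp X` to
`exp Y`. -/
theorem exp_sub_exp (X Y : 𝔸) :
    exp Y - exp X = ∫ τ in (0 : ℝ)..1, exp ((1 - τ) • X) * (Y - X) * exp (τ • Y) := by
  have hd : ∀ τ : ℝ, HasDerivAt (fun τ : ℝ => exp ((1 - τ) • X) * exp (τ • Y))
      (exp ((1 - τ) • X) * (Y - X) * exp (τ • Y)) τ := by
    intro τ
    have h1 := (hasDerivAt_exp_smul_const (𝕂 := ℝ) X (1 - τ)).scomp τ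
      ((hasDerivAt_id τ).const_sub 1)
    have h2 := hasDerivAt_exp_smul_const' (𝕂 := ℝ) Y τ
    refine (h1.mul h2).congr_deriv ?_
    simp
    noncomm_ring
  have hc := continuous_exp_real (𝔸 := 𝔸)
  rw [intervalIntegral.integral_eq_sub_of_hasDerivAt (fun τ _ => hd τ)]
  · simp
  · apply Continuous.intervalIntegrable
    fun_prop

theorem exp_mul_dexp (A B : 𝔸) :
    exp A * dexp A B = ∫ τ in (0 : ℝ)..1, exp ((1 - τ) • A) * B * exp (τ • A) := by
  have h := (ContinuousLinearMap.mul ℝ 𝔸 (exp A)).intervalIntegral_comp_comm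
    ((continuous_conjExp_smul A B).intervalIntegrable (μ := volume) 0 1)
  rw [ContinuousLinearMap.mul_apply'] at h
  rw [dexp, ← h]
  refine intervalIntegral.integral_congr fun τ _ => ?_
  have := exp_smul_add 1 (-τ) A
  rw [one_smul] at this
  simp only [conjExp, sub_eq_add_neg, this, neg_smul, mul_assoc, ContinuousLinearMap.mul_apply']

theorem _root_.HasDerivWithinAt.exp_dexp {q : ℝ → 𝔸} {q' : 𝔸} {S : Set ℝ} {t : ℝ}
    (h : HasDerivWithinAt q q' S t) :
    HasDerivWithinAt (fun r => exp (q r)) (exp (q t) * dexp (q t) q') S t := by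
  have hq : Tendsto q (𝓝[S \ {t}] t) (𝓝 (q t)) :=
    h.continuousWithinAt.mono_left (nhdsWithin_mono _ sdiff_subset)
  rw [hasDerivWithinAt_iff_tendsto_slope] at h ⊢
  have hc := continuous_exp_real (𝔸 := 𝔸)
  -- By Duhamel the difference quotient of `exp ∘ q` is this continuous function evaluated at `q r`
  -- and the difference quotient of `q`; its limit is therefore immediate, also at an endpoint of an
  -- interval.
  have hΦ : Continuous fun p : 𝔸 × 𝔸 =>
      ∫ τ in (0 : ℝ)..1, exp ((1 - τ) • q t) * p.2 * exp (τ • p.1) := by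
    apply intervalIntegral.continuous_parametric_intervalIntegral_of_continuous'
    fun_prop
  have hlim := (hΦ.tendsto (q t, q')).comp (hq.prodMk_nhds h)
  rw [exp_mul_dexp]
  refine hlim.congr fun r => ?_
  simp only [Function.comp_apply, slope, vsub_eq_sub]
  rw [exp_sub_exp, ← intervalIntegral.integral_smul]
  simp

/-- `Ad(exp(-tX)) C_s(t)` for the path `Q` with derivative `Q'`. -/
def variationField (X : 𝔸) (Q Q' : ℝ → 𝔸) (s t : ℝ) : 𝔸 :=
  conjExp (t • X) (dexp (s • Q t) (s • Q' t))

variable {X : 𝔸} {Q Q' : ℝ → 𝔸}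

@[simp] theorem conjExp_zero_left (B : 𝔸) : conjExp 0 B = B := by simp [conjExp]

@[simp] theorem variationField_zero (t : ℝ) : variationField X Q Q' 0 t = 0 := by
  simp [variationField, dexp, conjExp]

theorem continuous_conjExp_smul_path (hQ : Continuous Q) {B : ℝ → 𝔸}
    (hB : Continuous B) : Continuous fun p : ℝ × ℝ => conjExp (p.1 • Q p.2) (B p.2) := by
  have : Continuous fun p : ℝ × ℝ => (p.1 • Q p.2, B p.2) := by fun_prop
  exact continuous_conjExp.comp this

theorem continuous_conjExp_smul_field {B : ℝ × ℝ → 𝔸} (hB : Continuous B) :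
    Continuous fun p : ℝ × ℝ => conjExp (p.2 • X) (B p) := by
  have : Continuous fun p : ℝ × ℝ => (p.2 • X, B p) := by fun_prop
  exact continuous_conjExp.comp this

theorem continuous_variationField (hQ : Continuous Q) (hQ' : Continuous Q') :
    Continuous fun p : ℝ × ℝ => variationField X Q Q' p.1 p.2 := by
  have : Continuous fun p : ℝ × ℝ => (p.1 • Q p.2, p.1 • Q' p.2) := by fun_prop
  exact continuous_conjExp_smul_field (continuous_dexp.comp this)

theorem continuous_oppBracket_path (hQ : Continuous Q) (hQ' : Continuous Q') :
    Continuous fun t => oppBracket (Q t) (Q' t) :=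
  (hQ'.mul hQ).sub (hQ.mul hQ')

theorem _root_.HasDerivAt.conjExp_right {f : ℝ → 𝔸} {f' : 𝔸} {s : ℝ}
    (A : 𝔸) (h : HasDerivAt f f' s) :
    HasDerivAt (fun s => conjExp A (f s)) (conjExp A f') s :=
  (h.const_mul _).mul_const _

/-- No relation between `Q` and `Q'` enters here: only `s` varies, and `t` is a parameter. -/
theorem hasDerivAt_variationField (s t : ℝ) :
    HasDerivAt (fun s => variationField X Q Q' s t)
      (conjExp (t • X) (conjExp (s • Q t) (Q' t))) s :=
  (hasDerivAt_dexp_smul_smul (Q t) (Q' t) s).conjExp_right (t • X)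

end BanachAlgebra

/-! ### Closure of the roots of a parabolic under addition. -/

section RootCombinatorics

set_option linter.unusedSectionVars false

variable {ι R M N : Type*} [CommRing R] [CharZero R] [AddCommGroup M] [Module R M]
  [AddCommGroup N] [Module R N] {P : RootPairing ι R M N} (b : P.Base)

theorem root_eq_sum_of_isPos {i : ι} (hi : b.IsPos i) :
    ∃ f : ι → ℕ, P.root i = ∑ j ∈ b.support, f j • P.root j := by
  obtain ⟨f, -, hf | hf⟩ := b.exists_root_eq_sum_nat_or_neg i
  · exact ⟨f, hf⟩
  · have h := b.height_eq_sum (i := i) (f := fun j => -(f j : ℤ)) (by simp [hf])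
    rw [b.isPos_iff, h, Finset.sum_neg_distrib] at hi
    have : (0 : ℤ) ≤ ∑ j ∈ b.support, (f j : ℤ) := Finset.sum_nonneg fun _ _ => by positivity
    lia

theorem root_eq_neg_sum_of_not_isPos {i : ι} (hi : ¬ b.IsPos i) :
    ∃ f : ι → ℕ, P.root i = -∑ j ∈ b.support, f j • P.root j := by
  obtain ⟨f, -, hf | hf⟩ := b.exists_root_eq_sum_nat_or_neg i
  · have h := b.height_eq_sum (i := i) (f := fun j => (f j : ℤ)) (by simp [hf])
    have : (0 : ℤ) ≤ ∑ j ∈ b.support, (f j : ℤ) := Finset.sum_nonneg fun _ _ => by positivity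
    rw [b.isPos_iff'] at hi
    lia
  · exact ⟨f, hf⟩

theorem toWeightBasis_repr_sum [P.IsRootSystem] (f : ι → ℕ) (j : b.support) :
    b.toWeightBasis.repr (∑ i ∈ b.support, f i • P.root i) j = f j := by
  classical
  rw [← Finset.sum_coe_sort b.support (fun i => f i • P.root i)]
  simp only [map_sum, map_nsmul, b.toWeightBasis_repr_root]
  simp [Finsupp.single_apply]

/-- If the sum `k` is not positive, its coordinates outside `Θ` are at most `0`. They equal those of
the positive root `j`, hence vanish, so `j` and therefore `k` lie in the span of `Θ`. -/
theorem isPos_add_of_mem_closure [P.IsRootSystem] {Θ : Set ι} (hΘ : Θ ⊆ b.support) {i j k : ι}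
    (hi : P.root i ∈ AddSubgroup.closure (P.root '' Θ)) (hj : b.IsPos j)
    (hk : P.root k = P.root i + P.root j) :
    P.root k ∈ AddSubgroup.closure (P.root '' Θ) ∨ b.IsPos k := by
  classical
  by_contra! hcon
  obtain ⟨hk1, hk2⟩ := hcon
  obtain ⟨f, hf⟩ := root_eq_sum_of_isPos b hj
  obtain ⟨g, hg⟩ := root_eq_neg_sum_of_not_isPos b hk2
  have hcoef : ∀ l : b.support, (l : ι) ∉ Θ → f l = 0 := by
    intro l hl
    have h0 : ∀ x ∈ AddSubgroup.closure (P.root '' Θ), b.toWeightBasis.repr x l = 0 := by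
      intro x hx
      induction hx using AddSubgroup.closure_induction with
      | mem x hx =>
        obtain ⟨θ, hθ, rfl⟩ := hx
        rw [show θ = ((⟨θ, hΘ hθ⟩ : b.support) : ι) from rfl, b.toWeightBasis_repr_root,
          Finsupp.single_apply, if_neg]
        rintro rfl
        exact hl hθ
      | zero => simp
      | add x y _ _ hx hy => simp [hx, hy]
      | neg x _ hx => simp [hx]
    have h := congrArg (fun x => b.toWeightBasis.repr x l) hk
    simp only [hg, hf, map_neg, map_add, Finsupp.neg_apply, Finsupp.add_apply,
      toWeightBasis_repr_sum, h0 _ hi, zero_add] at h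
    have h' : ((g l + f l : ℕ) : R) = 0 := by push_cast; rw [← h]; ring
    have := Nat.cast_eq_zero.1 h'
    lia
  apply hk1
  rw [hk]
  refine add_mem hi ?_
  rw [hf]
  refine sum_mem fun l hl => ?_
  by_cases hlΘ : l ∈ Θ
  · exact AddSubgroup.nsmul_mem _ (AddSubgroup.subset_closure (mem_image_of_mem _ hlΘ)) _
  · rw [show f l = 0 from hcoef (⟨l, hl⟩ : b.support) hlΘ, zero_smul]
    exact zero_mem _

end RootCombinatorics

/-! ### Sums of root spaces: brackets and normalizers. -/

section RootSpaceSum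

set_option linter.unusedSectionVars false

variable {L : Type*} [LieRing L] [LieAlgebra ℂ L] [FiniteDimensional ℂ L]
  (H : LieSubalgebra ℂ L) [H.IsCartanSubalgebra]

/-- The sum of the root spaces for a set of functionals on a Cartan subalgebra. -/
def rootSpaceSum (Q : Set (H → ℂ)) : LieSubmodule ℂ H L :=
  ⨆ χ ∈ Q, LieAlgebra.rootSpace H χ

variable {H}

theorem rootSpace_le_rootSpaceSum {Q : Set (H → ℂ)} {χ : H → ℂ} (h : χ ∈ Q) :
    LieAlgebra.rootSpace H χ ≤ rootSpaceSum H Q :=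
  le_iSup₂_of_le χ h le_rfl

theorem rootSpaceSum_induction {Q : Set (H → ℂ)} {p : L → Prop} {x : L} (hx : x ∈ rootSpaceSum H Q)
    (mem : ∀ χ ∈ Q, ∀ y ∈ LieAlgebra.rootSpace H χ, p y) (zero : p 0)
    (add : ∀ y z, p y → p z → p (y + z)) : p x := by
  rw [rootSpaceSum, ← LieSubmodule.mem_toSubmodule] at hx
  simp only [LieSubmodule.iSup_toSubmodule] at hx
  induction hx using Submodule.iSup_induction' with
  | mem χ x hx =>
    induction hx using Submodule.iSup_induction' with
    | mem hχ x hx => exact mem χ hχ x hx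
    | zero => exact zero
    | add x y _ _ hx hy => exact add x y hx hy
  | zero => exact zero
  | add x y _ _ hx hy => exact add x y hx hy

theorem lie_mem_rootSpaceSum {Q : Set (H → ℂ)}
    (hQ : ∀ χ ∈ Q, ∀ ψ ∈ Q, LieAlgebra.rootSpace H (χ + ψ) ≠ ⊥ → χ + ψ ∈ Q)
    {x y : L} (hx : x ∈ rootSpaceSum H Q) (hy : y ∈ rootSpaceSum H Q) :
    ⁅x, y⁆ ∈ rootSpaceSum H Q := by
  refine rootSpaceSum_induction (p := fun x => ⁅x, y⁆ ∈ rootSpaceSum H Q) hx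
    (fun χ hχ x hx => ?_) (by simp) (fun x x' hx hx' => by rw [add_lie]; exact add_mem hx hx')
  refine rootSpaceSum_induction (p := fun y => ⁅x, y⁆ ∈ rootSpaceSum H Q) hy
    (fun ψ hψ y hy => ?_) (by simp) (fun y y' hy hy' => by rw [lie_add]; exact add_mem hy hy')
  have h := LieAlgebra.lie_mem_genWeightSpace_of_mem_genWeightSpace hx hy
  by_cases hb : LieAlgebra.rootSpace H (χ + ψ) = ⊥
  · rw [LieAlgebra.rootSpace] at hb
    rw [hb, LieSubmodule.mem_bot] at h
    rw [h]
    exact zero_mem _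
  · exact rootSpace_le_rootSpaceSum (hQ χ hχ ψ hψ hb) h

/-- Split off the component `z` of `x` with weights outside `Q`. Each `⁅h, z⁆` has weights both
inside and outside `Q`, so it vanishes; then `z` has weight `0`, which belongs to `Q`. -/
theorem mem_rootSpaceSum_of_lie_mem {Q : Set (H → ℂ)} (h0 : 0 ∈ Q) {x : L}
    (hx : ∀ h : H, ⁅(h : L), x⁆ ∈ rootSpaceSum H Q) : x ∈ rootSpaceSum H Q := by
  have hdisj : Disjoint (rootSpaceSum H Q) (rootSpaceSum H Qᶜ) :=
    (LieModule.iSupIndep_genWeightSpace ℂ H L).disjoint_biSup_biSup disjoint_compl_right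
  have htop : rootSpaceSum H Q ⊔ rootSpaceSum H Qᶜ = ⊤ := by
    rw [eq_top_iff, ← LieModule.iSup_genWeightSpace_eq_top ℂ H L, iSup_le_iff]
    intro χ
    by_cases hχ : χ ∈ Q
    · exact (rootSpace_le_rootSpaceSum hχ).trans le_sup_left
    · exact (rootSpace_le_rootSpaceSum (Q := Qᶜ) hχ).trans le_sup_right
  have hxt : x ∈ rootSpaceSum H Q ⊔ rootSpaceSum H Qᶜ := htop ▸ LieSubmodule.mem_top x
  obtain ⟨y, hy, z, hz, rfl⟩ := (LieSubmodule.mem_sup _ _ _).1 hxt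
  have hz0 : z ∈ LieAlgebra.rootSpace H (0 : H → ℂ) := by
    refine LieModule.weightSpace_le_genWeightSpace L _ ?_
    rw [LieModule.mem_weightSpace]
    intro h
    have h1 : ⁅h, z⁆ ∈ rootSpaceSum H Q := by
      have := sub_mem (hx h) (LieSubmodule.lie_mem _ (x := h) hy)
      rwa [LieSubalgebra.coe_bracket_of_module, ← lie_sub, add_sub_cancel_left] at this
    have h2 : ⁅h, z⁆ ∈ rootSpaceSum H Qᶜ := LieSubmodule.lie_mem _ hz
    have h3 := hdisj.le_bot ((LieSubmodule.mem_inf _ _ _).2 ⟨h1, h2⟩)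
    rw [(LieSubmodule.mem_bot _).1 h3]
    simp
  exact add_mem hy (rootSpace_le_rootSpaceSum h0 hz0)

end RootSpaceSum

/-! ### The standard parabolic is a self-normalizing subalgebra. -/

namespace Datum

variable {n : Type*} [Fintype n] [DecidableEq n] (D : Datum n)

/-- The weights of `𝔥` on `𝔭_Θ`. -/
def parabolicWeights : Set (D.𝔥 → ℂ) :=
  {χ | χ = 0 ∨ ∃ α : D.𝔥.root, (D.InSpanΘ α ∨ D.base.IsPos α) ∧ χ = (α.1 : D.𝔥 → ℂ)}

theorem 𝔭_eq_rootSpaceSum : D.𝔭 = (rootSpaceSum D.𝔥 D.parabolicWeights).toSubmodule := by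
  have hle : ∀ χ ∈ D.parabolicWeights, (LieAlgebra.rootSpace D.𝔥 χ).toSubmodule ≤
      (rootSpaceSum D.𝔥 D.parabolicWeights).toSubmodule :=
    fun χ hχ => LieSubmodule.toSubmodule_le_toSubmodule _ _ |>.2 (rootSpace_le_rootSpaceSum hχ)
  have h𝔥 : D.𝔥.toSubmodule = (LieAlgebra.rootSpace D.𝔥 (0 : D.𝔥 → ℂ)).toSubmodule := by
    rw [LieAlgebra.rootSpace_zero_eq]
    rfl
  apply le_antisymm
  · refine sup_le (sup_le ?_ (iSup_le fun α => hle _ (.inr ⟨α.1, .inl α.2.1, rfl⟩)))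
      (iSup_le fun α => hle _ (.inr ⟨α.1, .inr α.2, rfl⟩))
    rw [h𝔥]
    exact hle 0 (.inl rfl)
  · simp only [rootSpaceSum, LieSubmodule.iSup_toSubmodule]
    refine iSup₂_le ?_
    rintro χ (rfl | ⟨α, hα, rfl⟩)
    · rw [← h𝔥]
      exact le_sup_left.trans le_sup_left
    · by_cases hp : D.base.IsPos α
      · exact le_sup_of_le_right (le_iSup_of_le ⟨α, hp⟩ le_rfl)
      · exact le_sup_of_le_left (le_sup_of_le_right
          (le_iSup_of_le ⟨α, hα.resolve_right hp, hp⟩ le_rfl))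

theorem parabolicWeights_add (χ : D.𝔥 → ℂ) (hχ : χ ∈ D.parabolicWeights) (ψ : D.𝔥 → ℂ)
    (hψ : ψ ∈ D.parabolicWeights) (h : LieAlgebra.rootSpace D.𝔥 (χ + ψ) ≠ ⊥) :
    χ + ψ ∈ D.parabolicWeights := by
  obtain rfl | ⟨α, hα, rfl⟩ := hχ
  · rwa [zero_add]
  obtain rfl | ⟨β, hβ, rfl⟩ := hψ
  · rw [add_zero]
    exact .inr ⟨α, hα, rfl⟩
  by_cases h0 : ((α.1 : D.𝔥 → ℂ) + (β.1 : D.𝔥 → ℂ)) = 0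
  · exact .inl h0
  -- A nonzero sum with nonzero root space is a root, so the combinatorics of root sums applies.
  let w : LieModule.Weight ℂ D.𝔥 D.𝔤 := ⟨_, h⟩
  have hw : w ∈ D.𝔥.root := by
    simp only [LieSubalgebra.root, Finset.mem_filter, Finset.mem_univ, true_and]
    exact h0
  have hadd : (LieAlgebra.IsKilling.rootSystem D.𝔥).root ⟨w, hw⟩ =
      (LieAlgebra.IsKilling.rootSystem D.𝔥).root α +
        (LieAlgebra.IsKilling.rootSystem D.𝔥).root β := by
    ext x
    simp [w]
  refine .inr ⟨⟨w, hw⟩, ?_, rfl⟩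
  rcases hα with hα | hα <;> rcases hβ with hβ | hβ
  · left
    rw [InSpanΘ, hadd]
    exact add_mem hα hβ
  · exact isPos_add_of_mem_closure D.base D.Θ_subset hα hβ hadd
  · exact isPos_add_of_mem_closure D.base D.Θ_subset hβ hα (hadd.trans (add_comm _ _))
  · exact .inr (hα.add hβ hadd)

theorem lie_mem_𝔭 {x y : D.𝔤} (hx : x ∈ D.𝔭) (hy : y ∈ D.𝔭) : ⁅x, y⁆ ∈ D.𝔭 := by
  rw [𝔭_eq_rootSpaceSum] at *
  exact lie_mem_rootSpaceSum D.parabolicWeights_add hx hy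

/-- The parabolic subalgebra is self-normalizing. -/
theorem mem_𝔭_of_forall_lie_mem {x : D.𝔤} (hx : ∀ y ∈ D.𝔭, ⁅x, y⁆ ∈ D.𝔭) : x ∈ D.𝔭 := by
  have h𝔥 : ∀ h : D.𝔥, (h : D.𝔤) ∈ D.𝔭 := fun h =>
    Submodule.mem_sup_left (Submodule.mem_sup_left h.2)
  have hx' : ∀ h : D.𝔥, ⁅(h : D.𝔤), x⁆ ∈ D.𝔭 := fun h => by
    rw [← lie_skew]
    exact neg_mem (hx _ (h𝔥 h))
  rw [𝔭_eq_rootSpaceSum] at *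
  exact mem_rootSpaceSum_of_lie_mem (.inl rfl) hx'

end Datum

/-! ### Adjoint action and invariant subspaces of matrices, with an auxiliary submultiplicative
norm. -/

section MatrixCalculus

set_option linter.unusedSectionVars false

attribute [local instance] Matrix.linftyOpNormedRing Matrix.linftyOpNormedAlgebra

variable {n : Type*} [Fintype n] [DecidableEq n]

theorem rightBracket_eq_oppBracket (A B : Matrix n n ℂ) : rightBracket A B = oppBracket A B := rfl

theorem expDiff_eq_dexp (A B : Matrix n n ℂ) : expDiff A B = dexp A B :=
  (hasSum_dexp A B).tsum_eq

theorem Ad_expGL (A B : Matrix n n ℂ) : Ad (expGL A) B = conjExp (-A) B := by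
  rw [conjExp, neg_neg]
  rfl

theorem Ad_mul (g h : GL n ℂ) (A : Matrix n n ℂ) : Ad (g * h) A = Ad g (Ad h A) := by
  simp only [Ad, mul_inv_rev, Units.val_mul, mul_assoc]

@[simp] theorem Ad_one (A : Matrix n n ℂ) : Ad 1 A = A := by simp [Ad]

theorem Ad_add (g : GL n ℂ) (A B : Matrix n n ℂ) : Ad g (A + B) = Ad g A + Ad g B := by
  simp [Ad, mul_add, add_mul]

theorem Ad_smul (g : GL n ℂ) (c : ℂ) (A : Matrix n n ℂ) : Ad g (c • A) = c • Ad g A := by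
  simp [Ad]

theorem Ad_lie (g : GL n ℂ) (A B : Matrix n n ℂ) : Ad g ⁅A, B⁆ = ⁅Ad g A, Ad g B⁆ := by
  simp only [Ad, LieRing.of_associative_ring_bracket, mul_sub, sub_mul, mul_assoc,
    Units.inv_mul_cancel_left]

@[simp] theorem Ad_inv_Ad (g : GL n ℂ) (A : Matrix n n ℂ) : Ad g⁻¹ (Ad g A) = A := by
  rw [← Ad_mul, inv_mul_cancel, Ad_one]

@[simp] theorem Ad_Ad_inv (g : GL n ℂ) (A : Matrix n n ℂ) : Ad g (Ad g⁻¹ A) = A := by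
  rw [← Ad_mul, mul_inv_cancel, Ad_one]

theorem expGL_inv (A : Matrix n n ℂ) : (expGL A)⁻¹ = expGL (-A) := by
  ext1
  rfl

theorem mem_of_hasSum {V : Submodule ℝ (Matrix n n ℂ)} {f : ℕ → Matrix n n ℂ} {x : Matrix n n ℂ}
    (hf : ∀ k, f k ∈ V) (h : HasSum f x) : x ∈ V :=
  (V.closed_of_finiteDimensional).mem_of_tendsto h
    (Eventually.of_forall fun _ => sum_mem fun k _ => hf k)

theorem iterate_oppBracket_mem {V : Submodule ℝ (Matrix n n ℂ)} {A B : Matrix n n ℂ}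
    (hA : ∀ B ∈ V, oppBracket A B ∈ V) (hB : B ∈ V) (k : ℕ) : (oppBracket A)^[k] B ∈ V := by
  induction k with
  | zero => exact hB
  | succ k ih => rw [Function.iterate_succ_apply']; exact hA _ ih

theorem conjExp_mem {V : Submodule ℝ (Matrix n n ℂ)} {A B : Matrix n n ℂ}
    (hA : ∀ B ∈ V, oppBracket A B ∈ V) (hB : B ∈ V) : conjExp A B ∈ V := by
  have h := hasSum_conjExp A B 1
  rw [one_smul] at h
  exact mem_of_hasSum (fun k => V.smul_mem _ (iterate_oppBracket_mem hA hB k)) h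

theorem dexp_mem {V : Submodule ℝ (Matrix n n ℂ)} {A B : Matrix n n ℂ}
    (hA : ∀ B ∈ V, oppBracket A B ∈ V) (hB : B ∈ V) : dexp A B ∈ V :=
  mem_of_hasSum (fun k => V.smul_mem _ (iterate_oppBracket_mem hA hB k)) (hasSum_dexp A B)

theorem Ad_expGL_mem {V : Submodule ℝ (Matrix n n ℂ)} {A B : Matrix n n ℂ}
    (hA : ∀ B ∈ V, oppBracket A B ∈ V) (hB : B ∈ V) : Ad (expGL A) B ∈ V := by
  rw [Ad_expGL]
  refine conjExp_mem (fun B hB => ?_) hB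
  have : oppBracket (-A) B = -oppBracket A B := by simp [oppBracket]; abel
  rw [this]
  exact neg_mem (hA B hB)

theorem Ad_mem_of_mem_closure {V T : Submodule ℝ (Matrix n n ℂ)}
    (hT : ∀ A ∈ T, ∀ B ∈ V, oppBracket A B ∈ V) {g : GL n ℂ}
    (hg : g ∈ Subgroup.closure {g | ∃ A ∈ T, g = expGL A}) {B : Matrix n n ℂ} (hB : B ∈ V) :
    Ad g B ∈ V := by
  suffices h : (∀ B ∈ V, Ad g B ∈ V) ∧ ∀ B ∈ V, Ad g⁻¹ B ∈ V from h.1 B hB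
  induction hg using Subgroup.closure_induction with
  | mem g hg =>
    obtain ⟨A, hA, rfl⟩ := hg
    rw [expGL_inv]
    exact ⟨fun B => Ad_expGL_mem (hT A hA), fun B => Ad_expGL_mem (hT _ (neg_mem hA))⟩
  | one => simp
  | mul g h _ _ hg hh =>
    simp only [mul_inv_rev, Ad_mul]
    exact ⟨fun B hB => hg.1 _ (hh.1 _ hB), fun B hB => hh.2 _ (hg.2 _ hB)⟩
  | inv g _ hg =>
    rw [inv_inv]
    exact hg.symm

/-- Otherwise some linear functional vanishes on `V` but not at `c'`; composed with `c` it would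
have two different derivatives. -/
theorem derivWithin_mem {V : Submodule ℝ (Matrix n n ℂ)} {c : ℝ → Matrix n n ℂ}
    {c' : Matrix n n ℂ} {S : Set ℝ} {t : ℝ} (hS : UniqueDiffWithinAt ℝ S t)
    (hc : HasDerivWithinAt c c' S t) (hV : ∀ᶠ r in 𝓝[S] t, c r ∈ V) (ht : c t ∈ V) : c' ∈ V := by
  by_contra hn
  obtain ⟨f, hf, hfV⟩ := Submodule.exists_le_ker_of_notMem hn
  have h1 : HasDerivWithinAt (fun r => f (c r)) (f c') S t :=
    (LinearMap.toContinuousLinearMap f).hasFDerivAt.comp_hasDerivWithinAt t hc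
  have h2 : HasDerivWithinAt (fun r => f (c r)) 0 S t :=
    (hasDerivWithinAt_const t S (0 : ℝ)).congr_of_eventuallyEq
      (hV.mono fun r hr => hfV hr) (hfV ht)
  exact hf (hS.eq_deriv _ h1 h2)

theorem hasDerivWithinAt_inv {g : ℝ → GL n ℂ} {g' : Matrix n n ℂ} {S : Set ℝ} {t : ℝ}
    (h : HasDerivWithinAt (fun r => (g r : Matrix n n ℂ)) g' S t) :
    HasDerivWithinAt (fun r => ((g r)⁻¹ : GL n ℂ).val)
      (-(((g t)⁻¹ : GL n ℂ).val * g' * ((g t)⁻¹ : GL n ℂ).val)) S t := by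
  have h1 := (hasFDerivAt_ringInverse (𝕜 := ℝ) (g t)).comp_hasDerivWithinAt t h
  simpa [Function.comp_def] using! h1

end MatrixCalculus

/-! ### Invariance of `𝔤`, `𝔲`, `𝔭`, and the Killing form on the compact real form. -/

namespace Datum

attribute [local instance] Matrix.linftyOpNormedRing Matrix.linftyOpNormedAlgebra

variable {n : Type*} [Fintype n] [DecidableEq n] (D : Datum n)

theorem real_smul_eq (r : ℝ) (A : D.𝔤) : r • A = (r : ℂ) • A := by
  apply Subtype.ext
  ext i j
  simp

instance isScalarTower_real_complex : IsScalarTower ℝ ℂ D.𝔤 :=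
  ⟨fun r c A => by rw [real_smul_eq, smul_smul, Complex.real_smul]⟩

instance finite_real : Module.Finite ℝ D.𝔤 := Module.Finite.trans ℂ D.𝔤

/-- The inclusion of `𝔤` in the matrices, as a real linear map. -/
def inclR : D.𝔤 →ₗ[ℝ] Matrix n n ℂ where
  toFun A := A
  map_add' _ _ := rfl
  map_smul' _ _ := rfl

@[simp] theorem inclR_apply (A : D.𝔤) : D.inclR A = (A : Matrix n n ℂ) := rfl

theorem inclR_injective : Function.Injective D.inclR := Subtype.val_injective

theorem oppBracket_mem_map_inclR {V T : Submodule ℝ D.𝔤} (h : ∀ A ∈ T, ∀ B ∈ V, ⁅A, B⁆ ∈ V) :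
    ∀ A ∈ T.map D.inclR, ∀ B ∈ V.map D.inclR, oppBracket A B ∈ V.map D.inclR := by
  rintro _ ⟨A, hA, rfl⟩ _ ⟨B, hB, rfl⟩
  refine ⟨-⁅A, B⁆, neg_mem (h A hA B hB), ?_⟩
  simp [oppBracket, LieRing.of_associative_ring_bracket]

/-- The compact real form as a space of matrices. -/
def uMat : Submodule ℝ (Matrix n n ℂ) := D.𝔲.map D.inclR

/-- The parabolic subalgebra as a space of matrices. -/
def pMat : Submodule ℝ (Matrix n n ℂ) := (D.𝔭.restrictScalars ℝ).map D.inclR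

/-- The Lie algebra as a space of matrices. -/
def gMat : Submodule ℝ (Matrix n n ℂ) := (⊤ : Submodule ℝ D.𝔤).map D.inclR

theorem coe_mem_gMat (A : D.𝔤) : (A : Matrix n n ℂ) ∈ D.gMat := ⟨A, trivial, rfl⟩

variable {D} in
theorem mem_gMat {A : Matrix n n ℂ} : A ∈ D.gMat ↔ A ∈ D.𝔤 :=
  ⟨fun ⟨B, _, h⟩ => h ▸ B.2, fun h => D.coe_mem_gMat ⟨A, h⟩⟩

theorem mat_mem_uMat (A : D.𝔲) : mat A ∈ D.uMat := ⟨A, A.2, rfl⟩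

variable {D} in
theorem coe_mem_pMat {A : D.𝔤} : (A : Matrix n n ℂ) ∈ D.pMat ↔ A ∈ D.𝔭 :=
  ⟨fun ⟨_, hB, h⟩ => D.inclR_injective h ▸ hB, fun h => ⟨A, h, rfl⟩⟩

theorem uMat_le_gMat : D.uMat ≤ D.gMat := Submodule.map_mono le_top

theorem oppBracket_mem_gMat : ∀ A ∈ D.gMat, ∀ B ∈ D.gMat, oppBracket A B ∈ D.gMat :=
  D.oppBracket_mem_map_inclR fun _ _ _ _ => trivial

theorem oppBracket_mem_uMat : ∀ A ∈ D.uMat, ∀ B ∈ D.uMat, oppBracket A B ∈ D.uMat :=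
  D.oppBracket_mem_map_inclR D.lie_mem

theorem oppBracket_mem_pMat : ∀ A ∈ D.pMat, ∀ B ∈ D.pMat, oppBracket A B ∈ D.pMat :=
  D.oppBracket_mem_map_inclR fun _ hA _ hB => D.lie_mem_𝔭 hA hB

variable {D} in
theorem mem_pMat_iff {A : Matrix n n ℂ} :
    A ∈ D.pMat ↔ A ∈ D.𝔭.map D.𝔤.toSubmodule.subtype := by
  rw [pMat, Submodule.mem_map, Submodule.mem_map]
  rfl

variable {D} in
theorem Ad_mem_gMat {g : GL n ℂ} (hg : g ∈ D.G) {A : Matrix n n ℂ} (hA : A ∈ D.gMat) :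
    Ad g A ∈ D.gMat := by
  refine Ad_mem_of_mem_closure (T := D.gMat) D.oppBracket_mem_gMat ?_ hA
  refine Subgroup.closure_mono ?_ hg
  rintro _ ⟨A, rfl⟩
  exact ⟨A, D.coe_mem_gMat A, rfl⟩

variable {D} in
theorem Ad_mem_uMat {g : GL n ℂ} (hg : g ∈ D.U) {A : Matrix n n ℂ} (hA : A ∈ D.uMat) :
    Ad g A ∈ D.uMat := by
  refine Ad_mem_of_mem_closure (T := D.uMat) D.oppBracket_mem_uMat ?_ hA
  refine Subgroup.closure_mono ?_ hg
  rintro _ ⟨A, rfl⟩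
  exact ⟨mat A, D.mat_mem_uMat A, rfl⟩

theorem U_le_G : D.U ≤ D.G :=
  Subgroup.closure_mono fun _ ⟨A, h⟩ => ⟨A.1, h⟩

variable {D} in
theorem Ad_mem_pMat {g : GL n ℂ} (hg : g ∈ D.P) {A : Matrix n n ℂ} (hA : A ∈ D.pMat) :
    Ad g A ∈ D.pMat := by
  rw [mem_pMat_iff] at *
  exact (hg.2 A).1 hA

theorem expGL_mem_P {A : Matrix n n ℂ} (hA : A ∈ D.pMat) : expGL A ∈ D.P := by
  have hG : expGL A ∈ D.G := by
    obtain ⟨A, -, rfl⟩ := hA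
    exact Subgroup.subset_closure ⟨A, rfl⟩
  have hmem : ∀ A ∈ D.pMat, ∀ B ∈ D.pMat, Ad (expGL A) B ∈ D.pMat :=
    fun A hA B hB => Ad_expGL_mem (D.oppBracket_mem_pMat A hA) hB
  refine ⟨hG, fun B => ?_⟩
  rw [← mem_pMat_iff, ← mem_pMat_iff]
  refine ⟨hmem A hA B, fun h => ?_⟩
  have := hmem (-A) (neg_mem hA) _ h
  rwa [← expGL_inv, Ad_inv_Ad] at this

/-- The adjoint action of an element of `G` on `𝔤`. -/
def AdEquiv (g : GL n ℂ) (hg : g ∈ D.G) : D.𝔤 ≃ₗ⁅ℂ⁆ D.𝔤 where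
  toFun A := ⟨Ad g A, mem_gMat.1 (Ad_mem_gMat hg (D.coe_mem_gMat A))⟩
  invFun A := ⟨Ad g⁻¹ A, mem_gMat.1 (Ad_mem_gMat (inv_mem hg) (D.coe_mem_gMat A))⟩
  map_add' _ _ := Subtype.ext (Ad_add g _ _)
  map_smul' c _ := Subtype.ext (Ad_smul g c _)
  map_lie' := Subtype.ext (Ad_lie g _ _)
  left_inv _ := Subtype.ext (Ad_inv_Ad g _)
  right_inv _ := Subtype.ext (Ad_Ad_inv g _)

variable {D} in
theorem killingForm_Ad {g : GL n ℂ} (hg : g ∈ D.G) {A B A' B' : D.𝔤}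
    (hA : Ad g A = (A' : Matrix n n ℂ)) (hB : Ad g B = (B' : Matrix n n ℂ)) :
    killingForm ℂ D.𝔤 A' B' = killingForm ℂ D.𝔤 A B := by
  have eA : A' = D.AdEquiv g hg A := Subtype.ext hA.symm
  have eB : B' = D.AdEquiv g hg B := Subtype.ext hB.symm
  rw [eA, eB, LieAlgebra.killingForm_of_equiv_apply]

section RealForm

theorem add_I_smul_eq_zero {A B : D.𝔤} (hA : A ∈ D.𝔲) (hB : B ∈ D.𝔲)
    (h : A + Complex.I • B = 0) : A = 0 ∧ B = 0 := by
  have hB0 : B = 0 := D.eq_zero B hB (by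
    rw [← neg_eq_of_add_eq_zero_right h]
    exact neg_mem hA)
  subst hB0
  simpa using h

theorem sum_smul_eq {ι : Type*} [Fintype ι] (b : ι → D.𝔲) (c : ι → ℂ) :
    ∑ i, c i • (b i : D.𝔤) = ((∑ i, (c i).re • b i : D.𝔲) : D.𝔤) +
      Complex.I • ((∑ i, (c i).im • b i : D.𝔲) : D.𝔤) := by
  simp only [Submodule.coe_sum, Submodule.coe_smul, Finset.smul_sum, ← Finset.sum_add_distrib]
  refine Finset.sum_congr rfl fun i _ => ?_
  rw [real_smul_eq, real_smul_eq, smul_smul, ← add_smul]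
  congr 1
  rw [mul_comm]
  exact (Complex.re_add_im _).symm

/-- A real basis of `𝔲` is a complex basis of `𝔤`. -/
def complexBasis {ι : Type*} [Fintype ι] (b : Module.Basis ι ℝ D.𝔲) : Module.Basis ι ℂ D.𝔤 :=
  Module.Basis.mk (v := fun i => (b i : D.𝔤))
    (by
      rw [Fintype.linearIndependent_iff]
      intro c hc
      rw [sum_smul_eq] at hc
      obtain ⟨h1, h2⟩ := D.add_I_smul_eq_zero (Subtype.coe_prop _) (Subtype.coe_prop _) hc
      have e1 := Fintype.linearIndependent_iff.1 b.linearIndependent _ (Subtype.ext h1)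
      have e2 := Fintype.linearIndependent_iff.1 b.linearIndependent _ (Subtype.ext h2)
      exact fun i => Complex.ext (e1 i) (e2 i))
    (by
      intro Z _
      obtain ⟨A, hA, B, hB, rfl⟩ := D.exists_add Z
      have hmem : ∀ A ∈ D.𝔲, A ∈ Submodule.span ℂ (range fun i => (b i : D.𝔤)) := by
        intro A hA
        have := congrArg (Subtype.val : D.𝔲 → D.𝔤) (b.sum_repr ⟨A, hA⟩)
        simp only [Submodule.coe_sum, Submodule.coe_smul, real_smul_eq] at this
        rw [← this]
        exact sum_mem fun i _ => Submodule.smul_mem _ _ (Submodule.subset_span ⟨i, rfl⟩)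
      exact add_mem (hmem A hA) (Submodule.smul_mem _ _ (hmem B hB)))

theorem complexBasis_repr_im {ι : Type*} [Fintype ι] (b : Module.Basis ι ℝ D.𝔲) {A : D.𝔤}
    (hA : A ∈ D.𝔲) (i : ι) : ((D.complexBasis b).repr A i).im = 0 := by
  have h := congrArg (Subtype.val : D.𝔲 → D.𝔤) (b.sum_repr ⟨A, hA⟩)
  simp only [Submodule.coe_sum, Submodule.coe_smul, real_smul_eq] at h
  have hb : ∀ i, (b i : D.𝔤) = D.complexBasis b i := fun i => by simp [complexBasis]
  simp only [hb] at h
  rw [← h, Module.Basis.repr_sum_self]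
  simp

/-- In a complex basis of `𝔤` taken from `𝔲`, the operator `ad A ∘ ad B` has real diagonal entries,
so its trace is real. -/
theorem killingForm_im {A B : D.𝔤} (hA : A ∈ D.𝔲) (hB : B ∈ D.𝔲) :
    (killingForm ℂ D.𝔤 A B).im = 0 := by
  classical
  let b := Module.finBasis ℝ D.𝔲
  rw [killingForm_apply_apply, LinearMap.trace_eq_matrix_trace ℂ (D.complexBasis b), Matrix.trace,
    Complex.im_sum]
  refine Finset.sum_eq_zero fun i _ => ?_
  rw [Matrix.diag_apply, LinearMap.toMatrix_apply]
  apply complexBasis_repr_im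
  have hb : D.complexBasis b i = (b i : D.𝔤) := by simp [complexBasis]
  rw [hb]
  exact D.lie_mem _ hA _ (D.lie_mem _ hB _ (b i).2)

/-- The real part of the Killing form. -/
def killingRe : LinearMap.BilinForm ℝ D.𝔤 :=
  LinearMap.mk₂ ℝ (fun A B => (killingForm ℂ D.𝔤 A B).re) (by simp)
    (fun r A B => by rw [real_smul_eq, map_smul, LinearMap.smul_apply]; simp) (by simp)
    (fun r A B => by rw [real_smul_eq, map_smul]; simp)

@[simp] theorem killingRe_apply (A B : D.𝔤) : D.killingRe A B = (killingForm ℂ D.𝔤 A B).re := rfl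

theorem killingForm_symm (A B : D.𝔤) : killingForm ℂ D.𝔤 A B = killingForm ℂ D.𝔤 B A :=
  LieModule.traceForm_comm ℂ D.𝔤 D.𝔤 A B

/-- Negative definiteness makes the real Killing form nondegenerate on `𝔨`, so its orthogonal is a
complement. Orthogonality for the real part is full orthogonality, since the form is real on `𝔲`. -/
theorem exists_add_𝔨_𝔪 {Z : D.𝔤} (hZ : Z ∈ D.𝔲) : ∃ N ∈ D.𝔨, ∃ M ∈ D.𝔪, Z = N + M := by
  have hrefl : D.killingRe.IsRefl := fun A B h => by
    rw [killingRe_apply] at *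
    rwa [killingForm_symm]
  have hnd : (D.killingRe.restrict D.𝔨).Nondegenerate := by
    have key : ∀ A : D.𝔨, D.killingRe A A = 0 → A = 0 := by
      intro A hA
      by_contra h0
      have h1 := D.killing_neg A A.2.1 (fun h => h0 (Subtype.ext h))
      rw [killingRe_apply] at hA
      linarith
    exact ⟨fun A hA => key A (hA A), fun A hA => key A (hA A)⟩
  have hc := LinearMap.BilinForm.isCompl_orthogonal_of_restrict_nondegenerate hrefl hnd
  obtain ⟨N, hN, M, hM, rfl⟩ := Submodule.mem_sup.1
    (show Z ∈ D.𝔨 ⊔ D.killingRe.orthogonal D.𝔨 by rw [hc.sup_eq_top]; trivial)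
  have hMu : M ∈ D.𝔲 := by simpa using sub_mem hZ hN.1
  refine ⟨N, hN, M, ⟨hMu, fun B hB => ?_⟩, rfl⟩
  rw [killingForm_symm]
  exact Complex.ext (hM B hB) (D.killingForm_im hB.1 hMu)

end RealForm

end Datum

/-! ### The projection on `𝔪`, invariant metrics and speeds of curves. -/

namespace Datum

attribute [local instance] Matrix.linftyOpNormedRing Matrix.linftyOpNormedAlgebra

variable {n : Type*} [Fintype n] [DecidableEq n] {D : Datum n}

theorem mPart_eq {A : Matrix n n ℂ} (N : D.𝔨) (M : D.𝔪) (h : A = mat N + mat M) :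
    D.mPart A = M := by
  have hex : ∃ M : D.𝔪, ∃ N : D.𝔨, A = mat N + mat M := ⟨M, N, h⟩
  rw [mPart, dif_pos hex]
  obtain ⟨N', h'⟩ := hex.choose_spec
  set M' := hex.choose
  have hNM : (N : D.𝔤) + M = N' + M' := Subtype.ext (h.symm.trans h')
  have hd : ((M' - M : D.𝔪) : D.𝔤) = ((N - N' : D.𝔨) : D.𝔤) := by
    rw [Submodule.coe_sub, Submodule.coe_sub, sub_eq_sub_iff_add_eq_add, add_comm, ← hNM]
  -- The difference lies in both `𝔨` and `𝔪`, so it is orthogonal to itself; definiteness makes it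
  -- zero.
  have hz : ((M' - M : D.𝔪) : D.𝔤) = 0 := by
    by_contra h0
    have h1 := D.killing_neg _ (M' - M).2.1 h0
    have h2 := (M' - M).2.2 _ (N - N').2
    rw [← hd] at h2
    rw [h2] at h1
    exact lt_irrefl _ h1
  exact sub_eq_zero.1 (Subtype.ext hz)

theorem exists_mPart {A : Matrix n n ℂ} (hA : A ∈ D.uMat) :
    ∃ N : D.𝔨, A = mat N + mat (D.mPart A) := by
  obtain ⟨Z, hZ, rfl⟩ := hA
  obtain ⟨N, hN, M, hM, rfl⟩ := D.exists_add_𝔨_𝔪 hZ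
  refine ⟨⟨N, hN⟩, ?_⟩
  rw [mPart_eq (A := D.inclR (N + M)) ⟨N, hN⟩ ⟨M, hM⟩ rfl]
  rfl

@[simp] theorem mPart_mat (M : D.𝔪) : D.mPart (mat M) = M :=
  mPart_eq 0 M (by simp [mat])

theorem mPart_add {A B : Matrix n n ℂ} (hA : A ∈ D.uMat) (hB : B ∈ D.uMat) :
    D.mPart (A + B) = D.mPart A + D.mPart B := by
  obtain ⟨N, hN⟩ := exists_mPart hA
  obtain ⟨N', hN'⟩ := exists_mPart hB
  refine mPart_eq (N + N') _ ?_
  conv_lhs => rw [hN, hN']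
  exact add_add_add_comm _ _ _ _

theorem mPart_smul (r : ℝ) {A : Matrix n n ℂ} (hA : A ∈ D.uMat) :
    D.mPart (r • A) = r • D.mPart A := by
  obtain ⟨N, hN⟩ := exists_mPart hA
  refine mPart_eq (r • N) _ ?_
  conv_lhs => rw [hN]
  rw [smul_add]
  rfl

theorem mat_𝔪_mem_uMat (M : D.𝔪) : mat M ∈ D.uMat := ⟨M, M.2.1, rfl⟩

theorem mat_𝔨_mem_uMat (N : D.𝔨) : mat N ∈ D.uMat := ⟨N, N.2.1, rfl⟩

theorem mat_𝔨_mem_pMat (N : D.𝔨) : mat N ∈ D.pMat := ⟨N, N.2.2, rfl⟩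

theorem exists_𝔨_of_mem {A : Matrix n n ℂ} (hu : A ∈ D.uMat) (hp : A ∈ D.pMat) :
    ∃ N : D.𝔨, mat N = A := by
  obtain ⟨Z, hZ, rfl⟩ := hu
  exact ⟨⟨Z, hZ, coe_mem_pMat.1 hp⟩, rfl⟩

theorem exists_Ad_𝔨 {k : D.U} (hk : k ∈ D.K) (N : D.𝔨) :
    ∃ N' : D.𝔨, mat N' = Ad (k : GL n ℂ) (mat N) :=
  exists_𝔨_of_mem (Ad_mem_uMat k.2 (mat_𝔨_mem_uMat N)) (Ad_mem_pMat hk (mat_𝔨_mem_pMat N))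

theorem exists_Ad_𝔪 {k : D.U} (hk : k ∈ D.K) (M : D.𝔪) :
    ∃ M' : D.𝔪, mat M' = Ad (k : GL n ℂ) (mat M) := by
  obtain ⟨Z, hZ, hZM⟩ := Ad_mem_uMat k.2 (mat_𝔪_mem_uMat M)
  refine ⟨⟨Z, hZ, fun B hB => ?_⟩, hZM⟩
  obtain ⟨B', hB'⟩ := exists_Ad_𝔨 (inv_mem hk) ⟨B, hB⟩
  have h1 : Ad (k : GL n ℂ) (mat B') = (B : Matrix n n ℂ) := by
    rw [hB', Subgroup.coe_inv, Ad_Ad_inv]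
  rw [killingForm_Ad (D.U_le_G k.2) hZM.symm h1]
  exact M.2.2 _ B'.2

theorem mat_mPart_Ad {k : D.U} (hk : k ∈ D.K) {A : Matrix n n ℂ} (hA : A ∈ D.uMat) :
    mat (D.mPart (Ad (k : GL n ℂ) A)) = Ad (k : GL n ℂ) (mat (D.mPart A)) := by
  obtain ⟨N, hN⟩ := exists_mPart hA
  obtain ⟨N', hN'⟩ := exists_Ad_𝔨 hk N
  obtain ⟨M', hM'⟩ := exists_Ad_𝔪 hk (D.mPart A)
  rw [← hM', mPart_eq N' M']
  rw [hN', hM', ← Ad_add, ← hN]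

/-- The scalar product `B_Λ`, as a bilinear form. -/
def InvariantMetric.bilin (Λ : D.InvariantMetric) : D.𝔪 →ₗ[ℝ] D.𝔪 →ₗ[ℝ] ℝ :=
  -(D.killingRe.compl₁₂ (D.𝔪.subtype ∘ₗ Λ.op) D.𝔪.subtype)

theorem InvariantMetric.bilin_apply (Λ : D.InvariantMetric) (A B : D.𝔪) :
    Λ.bilin A B = Λ.B A B := rfl

theorem InvariantMetric.B_comm (Λ : D.InvariantMetric) (A B : D.𝔪) : Λ.B A B = Λ.B B A := by
  rw [InvariantMetric.B, InvariantMetric.B, Λ.symm A B, killingForm_symm]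

theorem InvariantMetric.B_Ad (Λ : D.InvariantMetric) {k : D.U} (hk : k ∈ D.K) {A B A' B' : D.𝔪}
    (hA : Ad (k : GL n ℂ) (mat A) = mat A') (hB : Ad (k : GL n ℂ) (mat B) = mat B') :
    Λ.B A' B' = Λ.B A B := by
  rw [InvariantMetric.B, InvariantMetric.B,
    killingForm_Ad (D.U_le_G k.2) (Λ.equivariant k hk A A' hA) hB]

variable (D) in
-- Extending the projection beyond `𝔲` makes `B_Λ` a continuous bilinear form on a whole matrix
-- space, where product rules apply. The choice is immaterial, as the arguments of interest lie in
-- `𝔲`.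
theorem exists_mProj : ∃ f : Matrix n n ℂ →ₗ[ℝ] D.𝔪, ∀ A ∈ D.uMat, f A = D.mPart A := by
  let f₀ : D.uMat →ₗ[ℝ] D.𝔪 :=
    { toFun := fun A => D.mPart A
      map_add' := fun A B => mPart_add A.2 B.2
      map_smul' := fun r A => mPart_smul r A.2 }
  obtain ⟨f, hf⟩ := f₀.exists_extend
  exact ⟨f, fun A hA => congr($hf ⟨A, hA⟩)⟩

variable (D) in
/-- A linear extension to all matrices of the projection of `𝔲` on `𝔪`. -/
def mProj : Matrix n n ℂ →ₗ[ℝ] D.𝔪 := D.exists_mProj.choose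

theorem mProj_eq {A : Matrix n n ℂ} (hA : A ∈ D.uMat) : D.mProj A = D.mPart A :=
  D.exists_mProj.choose_spec A hA

/-- The extension of `B_Λ` to matrices through the projection on `𝔪`. -/
def InvariantMetric.form (Λ : D.InvariantMetric) : Matrix n n ℂ →L[ℝ] Matrix n n ℂ →L[ℝ] ℝ :=
  LinearMap.toContinuousBilinearMap (Λ.bilin.compl₁₂ D.mProj D.mProj)

theorem InvariantMetric.form_apply (Λ : D.InvariantMetric) (A B : Matrix n n ℂ) :
    Λ.form A B = Λ.B (D.mProj A) (D.mProj B) := rfl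

theorem InvariantMetric.form_eq (Λ : D.InvariantMetric) {A B : Matrix n n ℂ} (hA : A ∈ D.uMat)
    (hB : B ∈ D.uMat) : Λ.form A B = Λ.B (D.mPart A) (D.mPart B) := by
  rw [form_apply, mProj_eq hA, mProj_eq hB]

theorem InvariantMetric.form_comm (Λ : D.InvariantMetric) (A B : Matrix n n ℂ) :
    Λ.form A B = Λ.form B A := by
  rw [form_apply, form_apply, B_comm]

theorem InvariantMetric.form_Ad (Λ : D.InvariantMetric) {k : D.U} (hk : k ∈ D.K)
    {A B : Matrix n n ℂ} (hA : A ∈ D.uMat) (hB : B ∈ D.uMat) :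
    Λ.form (Ad (k : GL n ℂ) A) (Ad (k : GL n ℂ) B) = Λ.form A B := by
  rw [Λ.form_eq (Ad_mem_uMat k.2 hA) (Ad_mem_uMat k.2 hB), Λ.form_eq hA hB,
    Λ.B_Ad hk (mat_mPart_Ad hk hA).symm (mat_mPart_Ad hk hB).symm]

theorem InvariantMetric.form_apply_eq_zero (Λ : D.InvariantMetric) {A : Matrix n n ℂ} (N : D.𝔨) :
    Λ.form A (mat N) = 0 := by
  rw [form_apply, mProj_eq (mat_𝔨_mem_uMat N), mPart_eq (A := mat N) N 0 (by simp [mat]),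
    ← bilin_apply, map_zero]

/-- A differentiable curve in `P_Θ` through `1` has its velocity in `𝔭_Θ`. -/
theorem deriv_mem_pMat {h : ℝ → GL n ℂ} {W : Matrix n n ℂ} {S : Set ℝ} {t : ℝ}
    (hS : UniqueDiffWithinAt ℝ S t) (hW : W ∈ D.gMat) (ht : h t = 1)
    (hP : ∀ᶠ r in 𝓝[S] t, h r ∈ D.P)
    (hd : HasDerivWithinAt (fun r => (h r : Matrix n n ℂ)) W S t) : W ∈ D.pMat := by
  obtain ⟨Z, -, rfl⟩ := hW
  refine coe_mem_pMat.2 (D.mem_𝔭_of_forall_lie_mem fun B hB => ?_)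
  have hB' : (B : Matrix n n ℂ) ∈ D.pMat := coe_mem_pMat.2 hB
  -- The curve `r ↦ Ad(h r) B` stays in `𝔭`; its derivative at `t` is `⁅Z, B⁆`, so `Z` normalizes
  -- `𝔭`.
  have h1 := (hd.mul_const (B : Matrix n n ℂ)).mul (hasDerivWithinAt_inv hd)
  have h2 := derivWithin_mem hS h1 (hP.mono fun r hr => Ad_mem_pMat hr hB') (by simpa [ht] using hB')
  rw [← coe_mem_pMat]
  simpa [ht, LieRing.of_associative_ring_bracket, sub_eq_add_neg] using h2

/-- The length of a velocity of a curve in the flag manifold does not depend on the lift. -/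
theorem HasVelocity.B_eq (Λ : D.InvariantMetric) {c : ℝ → D.Flag} {S : Set ℝ} {t : ℝ}
    (hS : UniqueDiffWithinAt ℝ S t) (htS : t ∈ S) {u₁ u₂ : D.U} {A₁ A₂ : D.𝔪}
    (h₁ : HasVelocity c S t u₁ A₁) (h₂ : HasVelocity c S t u₂ A₂) : Λ.B A₁ A₁ = Λ.B A₂ A₂ := by
  obtain ⟨g₁, Z₁, hc₁, rfl, hd₁, rfl⟩ := h₁
  obtain ⟨g₂, Z₂, hc₂, rfl, hd₂, rfl⟩ := h₂
  have hK : ∀ᶠ r in 𝓝[S] t, (g₂ r)⁻¹ * g₁ r ∈ D.K := by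
    filter_upwards [hc₁, hc₂] with r h1 h2
    exact QuotientGroup.eq.1 (h2.trans h1.symm)
  set k : D.U := (g₂ t)⁻¹ * g₁ t with hk
  have hkK : k ∈ D.K := hK.self_of_nhdsWithin htS
  have hZ₁ := D.mat_mem_uMat Z₁
  have hZ₂ := D.mat_mem_uMat Z₂
  have hZ₂' : Ad ((k⁻¹ : D.U) : GL n ℂ) (mat Z₂) ∈ D.uMat := Ad_mem_uMat (k⁻¹).2 hZ₂
  have hW : mat Z₁ - Ad ((k⁻¹ : D.U) : GL n ℂ) (mat Z₂) ∈ D.uMat := sub_mem hZ₁ hZ₂'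
  have hd := ((hasDerivWithinAt_inv hd₂).mul hd₁).const_mul (((k⁻¹ : D.U) : GL n ℂ) : Matrix n n ℂ)
  -- The comparison curve `k⁻¹ g₂⁻¹ g₁` passes through `1` at `t` with velocity `Z₁ - Ad(k⁻¹) Z₂`.
  -- Thus `Z₁` and `Ad(k⁻¹) Z₂` agree modulo `𝔨`, and `Ad(K)`-invariance finishes.
  have hp := deriv_mem_pMat (D := D) (h := fun r => ((k⁻¹ * ((g₂ r)⁻¹ * g₁ r) : D.U) : GL n ℂ))
    (W := mat Z₁ - Ad ((k⁻¹ : D.U) : GL n ℂ) (mat Z₂)) hS (D.uMat_le_gMat hW)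
    (by simp [hk]) (hK.mono fun r hr => mul_mem (inv_mem hkK) hr) (by
      refine hd.congr_deriv ?_
      simp only [Ad, hk, mul_inv_rev, inv_inv, Subgroup.coe_mul, Subgroup.coe_inv, Units.val_mul,
        mul_assoc, neg_mul, mul_neg, mul_add, Units.inv_mul_cancel_left,
        Units.mul_inv_cancel_left]
      abel)
  obtain ⟨N, hN⟩ := exists_𝔨_of_mem hW hp
  have e : mat Z₁ = Ad ((k⁻¹ : D.U) : GL n ℂ) (mat Z₂) + mat N := by rw [hN]; abel
  rw [← Λ.form_eq hZ₁ hZ₁, ← Λ.form_eq hZ₂ hZ₂, ← Λ.form_Ad (inv_mem hkK) hZ₂ hZ₂, e, map_add,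
    Λ.form_apply_eq_zero, add_zero, Λ.form_comm, map_add, Λ.form_apply_eq_zero, add_zero]

theorem HasVelocity.speedSq_eq (Λ : D.InvariantMetric) {c : ℝ → D.Flag} {S : Set ℝ} {t : ℝ}
    (hS : UniqueDiffWithinAt ℝ S t) (htS : t ∈ S) {u : D.U} {A : D.𝔪}
    (h : HasVelocity c S t u A) : speedSq Λ c S t = Λ.B A A := by
  have hex : ∃ A : D.𝔪, ∃ u : D.U, HasVelocity c S t u A := ⟨A, u, h⟩
  rw [speedSq, dif_pos hex]
  exact HasVelocity.B_eq Λ hS htS hex.choose_spec.choose_spec h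

theorem conjExp_mem_uMat {A B : Matrix n n ℂ} (hA : A ∈ D.uMat) (hB : B ∈ D.uMat) :
    conjExp A B ∈ D.uMat :=
  conjExp_mem (D.oppBracket_mem_uMat A hA) hB

theorem dexp_mem_uMat {A B : Matrix n n ℂ} (hA : A ∈ D.uMat) (hB : B ∈ D.uMat) :
    dexp A B ∈ D.uMat :=
  dexp_mem (D.oppBracket_mem_uMat A hA) hB

theorem adPart_eq (X : D.𝔪) (t : ℝ) (A : Matrix n n ℂ) :
    adPart X t A = D.mPart (conjExp (t • mat X) A) := by
  have h := Ad_expGL (-(t • mat X)) A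
  rw [neg_neg] at h
  rw [← h]
  rfl

theorem HasVelocity.of_lift {c : ℝ → D.Flag} {S : Set ℝ} {t : ℝ} (g : ℝ → D.U)
    {Z : Matrix n n ℂ} (hZ : Z ∈ D.uMat) (hc : ∀ r, (QuotientGroup.mk (g r) : D.Flag) = c r)
    (hg : HasDerivWithinAt (fun r => ((g r : GL n ℂ) : Matrix n n ℂ))
      (((g t : GL n ℂ) : Matrix n n ℂ) * Z) S t) :
    HasVelocity c S t (g t) (D.mPart Z) := by
  obtain ⟨Z, hZ, rfl⟩ := hZ
  exact ⟨g, ⟨Z, hZ⟩, Eventually.of_forall hc, rfl, hg, rfl⟩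

theorem speedSq_of_lift (Λ : D.InvariantMetric) {c : ℝ → D.Flag} {S : Set ℝ} {t : ℝ}
    (hS : UniqueDiffWithinAt ℝ S t) (htS : t ∈ S) (g : ℝ → D.U) {Z : Matrix n n ℂ}
    (hZ : Z ∈ D.uMat) (hc : ∀ r, (QuotientGroup.mk (g r) : D.Flag) = c r)
    (hg : HasDerivWithinAt (fun r => ((g r : GL n ℂ) : Matrix n n ℂ))
      (((g t : GL n ℂ) : Matrix n n ℂ) * Z) S t) :
    speedSq Λ c S t = Λ.form Z Z := by
  rw [Λ.form_eq hZ hZ]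
  exact (HasVelocity.of_lift g hZ hc hg).speedSq_eq Λ hS htS

theorem hasDerivWithinAt_mat_smul (X : D.𝔪) (S : Set ℝ) (t : ℝ) :
    HasDerivWithinAt (fun r : ℝ => mat (r • X)) (mat X) S t := by
  simpa using! (hasDerivWithinAt_id t S).smul_const (mat X)

theorem speedSq_variation (Λ : D.InvariantMetric) (X : D.𝔪) {q : ℝ → D.𝔲} {q' : D.𝔲}
    {S : Set ℝ} {t : ℝ} (hS : UniqueDiffWithinAt ℝ S t) (htS : t ∈ S)
    (hq : HasDerivWithinAt (fun r => mat (q r)) (mat q') S t) (s : ℝ) :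
    speedSq Λ (variation X q s) S t =
      Λ.form (conjExp (t • mat X) (dexp (s • mat (q t)) (s • mat q')) + mat X)
        (conjExp (t • mat X) (dexp (s • mat (q t)) (s • mat q')) + mat X) := by
  have hX := mat_𝔪_mem_uMat X
  refine speedSq_of_lift Λ hS htS (fun r => expU (s • q r) * expU (r • toU X))
    (add_mem (conjExp_mem_uMat (D.uMat.smul_mem _ hX) (dexp_mem_uMat
      (D.uMat.smul_mem _ (D.mat_mem_uMat _)) (D.uMat.smul_mem _ (D.mat_mem_uMat _)))) hX)
    (fun r => by simp [variation, orbitCurve, origin]) ?_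
  have h1 := (hq.const_smul s).exp_dexp
  have h2 := (hasDerivAt_exp_smul_const (𝕂 := ℝ) (mat X) t).hasDerivWithinAt (s := S)
  exact (h1.mul h2).congr_deriv (mul_exp_mul_conjExp_add _ _ _ _).symm

/-- The lift `u exp(x + ry)` has logarithmic derivative `dexp x y` at `r = 0`; the left translation
by `u` drops out. -/
theorem chartQuad_eq (Λ : D.InvariantMetric) (u : D.U) (x y : D.𝔪) :
    chartQuad Λ u x y = Λ.form (dexp (mat x) (mat y)) (dexp (mat x) (mat y)) := by
  have hZ := dexp_mem_uMat (mat_𝔪_mem_uMat x) (mat_𝔪_mem_uMat y)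
  refine speedSq_of_lift Λ uniqueDiffWithinAt_univ (mem_univ _)
    (fun r => u * expU (toU (x + r • y))) hZ (fun r => by simp [chart, origin]) ?_
  have h0 : HasDerivWithinAt (fun r : ℝ => mat x + mat (r • y)) (mat y) univ 0 :=
    (hasDerivWithinAt_mat_smul y univ 0).const_add _
  refine (h0.exp_dexp.const_mul ((u : GL n ℂ) : Matrix n n ℂ)).congr_deriv ?_
  have e : mat x + mat ((0 : ℝ) • y) = mat x := by simp [mat]
  have e' : mat (toU (x + (0 : ℝ) • y)) = mat x := by simp [mat, toU]
  change _ = ((u : GL n ℂ) : Matrix n n ℂ) * NormedSpace.exp (mat (toU (x + (0 : ℝ) • y))) * _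
  rw [e, e', mul_assoc]
  rfl

theorem chartMetric_eq (Λ : D.InvariantMetric) (u : D.U) (x y z : D.𝔪) :
    chartMetric Λ u x y z = Λ.form (dexp (mat x) (mat y)) (dexp (mat x) (mat z)) := by
  have h : dexp (mat x) (mat (y + z)) = dexp (mat x) (mat y) + dexp (mat x) (mat z) :=
    dexp_add_right _ _ _
  rw [chartMetric, chartQuad_eq, chartQuad_eq, chartQuad_eq, h]
  simp only [map_add, add_apply]
  rw [Λ.form_comm (dexp (mat x) (mat z)) (dexp (mat x) (mat y))]
  ring

theorem InvariantMetric.hasDerivAt_form (Λ : D.InvariantMetric) {f g : ℝ → Matrix n n ℂ}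
    {f' g' : Matrix n n ℂ} {t : ℝ} (hf : HasDerivAt f f' t) (hg : HasDerivAt g g' t) :
    HasDerivAt (fun r => Λ.form (f r) (g r)) (Λ.form (f t) g' + Λ.form f' (g t)) t :=
  Λ.form.hasDerivAt_of_bilinear (fun _ => hf) fun _ => hg

/-! ### Geodesic vectors. -/

theorem isChartRep_orbitCurve (X : D.𝔪) :
    IsChartRep (orbitCurve X) 0 1 (fun t => t • X) (fun _ => X) 0 where
  zero := zero_smul ℝ X
  eq := Eventually.of_forall fun t => by
    rw [chart, one_mul]
    rfl
  deriv₁ := Eventually.of_forall fun t =>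
    hasDerivWithinAt_univ.1 (hasDerivWithinAt_mat_smul X univ t)
  deriv₂ := hasDerivAt_const _ _

/-- A geodesic vector satisfies `B_Λ([X, Z]_𝔪, X) = 0` for `Z ∈ 𝔪`. -/
theorem IsGeodesicVector.form_oppBracket_𝔪 {Λ : D.InvariantMetric} {X : D.𝔪}
    (h : IsGeodesicVector Λ X) (Z : D.𝔪) : Λ.form (oppBracket (mat X) (mat Z)) (mat X) = 0 := by
  have h0 := (h 0).2 _ _ _ _ (isChartRep_orbitCurve X) Z
  have hmat : ∀ (r : ℝ) (A : D.𝔪), mat (r • A) = r • mat A := fun _ _ => rfl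
  have hm0 : mat (0 : D.𝔪) = 0 := rfl
  simp only [chartMetric_eq, hmat, dexp_smul_self, hm0, dexp_zero_left, map_zero,
    zero_apply, zero_add] at h0
  -- The acceleration term has vanished. The two metric derivatives are `B_Λ(X, [X,Z])/2` and
  -- `B_Λ([Z,X], X)`; the equation takes the first minus half the second, which is `B_Λ([X,Z],X)`.
  have d1 := Λ.hasDerivAt_form (hasDerivAt_const 0 (mat X))
    (hasDerivAt_dexp_smul_zero (mat X) (mat Z))
  have d2 := Λ.hasDerivAt_form (hasDerivAt_dexp_smul_zero (mat Z) (mat X))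
    (hasDerivAt_dexp_smul_zero (mat Z) (mat X))
  rw [d1.deriv, d2.deriv] at h0
  have hneg : oppBracket (mat Z) (mat X) = -oppBracket (mat X) (mat Z) := by
    simp [oppBracket]
  simp only [map_zero, zero_apply, zero_smul, dexp_zero_left, hneg, map_smul, map_neg,
    smul_apply, neg_apply, smul_eq_mul, Λ.form_comm (mat X)] at h0
  linarith

/-- Differentiate the constant `B_Λ(Ad(exp rN) X, Ad(exp rN) X)` at `r = 0`; no geodesic condition
is needed in the isotropy directions. -/
theorem InvariantMetric.form_oppBracket_𝔨 (Λ : D.InvariantMetric) (X : D.𝔪) (N : D.𝔨) :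
    Λ.form (oppBracket (mat X) (mat N)) (mat X) = 0 := by
  have hd := hasDerivAt_conjExp_smul (-mat N) (mat X) 0
  have h1 := Λ.hasDerivAt_form hd hd
  have hconst : ∀ r : ℝ, Λ.form (conjExp (r • -mat N) (mat X)) (conjExp (r • -mat N) (mat X)) =
      Λ.form (mat X) (mat X) := by
    intro r
    let k : D.U := expU ⟨r • N, (r • N).2.1⟩
    have hk : k ∈ D.K := D.expGL_mem_P (mat_𝔨_mem_pMat (r • N))
    have e : Ad (k : GL n ℂ) (mat X) = conjExp (r • -mat N) (mat X) := by
      rw [smul_neg]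
      exact Ad_expGL _ _
    rw [← e, Λ.form_Ad hk (mat_𝔪_mem_uMat X) (mat_𝔪_mem_uMat X)]
  simp only [hconst] at h1
  have h2 := h1.unique (hasDerivAt_const (0 : ℝ) (Λ.form (mat X) (mat X)))
  have e : oppBracket (-mat N) (mat X) = oppBracket (mat X) (mat N) := by
    simp [oppBracket]
    abel
  have e' : ∀ B : Matrix n n ℂ, conjExp (0 : Matrix n n ℂ) B = B := by simp [conjExp]
  rw [zero_smul, e', e', e, Λ.form_comm (mat X)] at h2
  linarith

theorem IsGeodesicVector.form_oppBracket {Λ : D.InvariantMetric} {X : D.𝔪}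
    (h : IsGeodesicVector Λ X) {Y : Matrix n n ℂ} (hY : Y ∈ D.uMat) :
    Λ.form (oppBracket (mat X) Y) (mat X) = 0 := by
  obtain ⟨N, hN⟩ := exists_mPart hY
  have e : oppBracket (mat X) Y =
      oppBracket (mat X) (mat N) + oppBracket (mat X) (mat (D.mPart Y)) := by
    conv_lhs => rw [hN]
    simp only [oppBracket]
    noncomm_ring
  rw [e, map_add, add_apply, Λ.form_oppBracket_𝔨, h.form_oppBracket_𝔪, add_zero]

theorem IsGeodesicVector.form_conjExp {Λ : D.InvariantMetric} {X : D.𝔪}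
    (h : IsGeodesicVector Λ X) {Y : Matrix n n ℂ} (hY : Y ∈ D.uMat) (t : ℝ) :
    Λ.form (conjExp (t • mat X) Y) (mat X) = Λ.form Y (mat X) := by
  have hd : ∀ r, HasDerivAt (fun r : ℝ => Λ.form (conjExp (r • mat X) Y) (mat X)) 0 r := by
    intro r
    refine (Λ.hasDerivAt_form (hasDerivAt_conjExp_smul (mat X) Y r)
      (hasDerivAt_const r (mat X))).congr_deriv ?_
    rw [conjExp_oppBracket, h.form_oppBracket
      (conjExp_mem_uMat (D.uMat.smul_mem _ (mat_𝔪_mem_uMat X)) hY)]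
    simp
  have := is_const_of_deriv_eq_zero (fun r => (hd r).differentiableAt) (fun r => (hd r).deriv) t 0
  simpa [conjExp] using this

theorem variation_zero (X : D.𝔪) (q : ℝ → D.𝔲) : variation X q 0 = orbitCurve X := by
  funext t
  have h : expU ((0 : ℝ) • q t) = 1 := by
    apply Subtype.ext
    ext1
    change NormedSpace.exp ((0 : ℝ) • mat (q t)) = 1
    rw [zero_smul, NormedSpace.exp_zero]
  rw [variation, h, one_smul]

/-! ### Differentiating the energy integral twice in `s`. -/

section Smooth

variable {X : Matrix n n ℂ} {Q Q' : ℝ → Matrix n n ℂ}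

variable (Λ : D.InvariantMetric)

theorem InvariantMetric.continuous_form {α : Type*} [TopologicalSpace α]
    {f g : α → Matrix n n ℂ} (hf : Continuous f) (hg : Continuous g) :
    Continuous fun x => Λ.form (f x) (g x) :=
  (Λ.form.continuous.comp hf).clm_apply hg

/-- First variation of `∫ B_Λ(V_s, V_s + 2X)`. -/
theorem hasDerivAt_integral_form (hQ : Continuous Q) (hQ' : Continuous Q') (a s : ℝ) :
    HasDerivAt (fun s => ∫ t in (0 : ℝ)..a, Λ.form (variationField X Q Q' s t)
        (variationField X Q Q' s t + (2 : ℝ) • X))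
      (∫ t in (0 : ℝ)..a, 2 * Λ.form (conjExp (t • X) (conjExp (s • Q t) (Q' t)))
        (variationField X Q Q' s t + X)) s := by
  have hV := continuous_variationField (X := X) hQ hQ'
  refine hasDerivAt_integral_of_continuous
    (F := fun s t => Λ.form (variationField X Q Q' s t)
        (variationField X Q Q' s t + (2 : ℝ) • X))
    (F' := fun s t => 2 * Λ.form (conjExp (t • X) (conjExp (s • Q t) (Q' t)))
        (variationField X Q Q' s t + X)) (fun s => ?_) ?_ (fun s t => ?_) s
  · have hVs := hV.comp (by fun_prop : Continuous fun t : ℝ => (s, t))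
    exact Λ.continuous_form hVs (hVs.add continuous_const)
  · exact (Λ.continuous_form (continuous_conjExp_smul_field (continuous_conjExp_smul_path hQ hQ'))
      (hV.add continuous_const)).const_smul (2 : ℝ)
  · have h := hasDerivAt_variationField (X := X) (Q := Q) (Q' := Q') s t
    refine (Λ.hasDerivAt_form h (h.add_const ((2 : ℝ) • X))).congr_deriv ?_
    -- With `W = ∂_s V`, symmetry turns `B(V,W) + B(W,V+2X)` into `2 B(W,V+X)`.
    rw [Λ.form_comm (variationField X Q Q' s t)]
    simp only [map_add, map_smul, smul_eq_mul]
    ring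

/-- Second variation of `∫ B_Λ(V_s, V_s + 2X)`. -/
theorem hasDerivAt_integral_form_deriv (hQ : Continuous Q) (hQ' : Continuous Q') (a s : ℝ) :
    HasDerivAt (fun s => ∫ t in (0 : ℝ)..a,
        2 * Λ.form (conjExp (t • X) (conjExp (s • Q t) (Q' t))) (variationField X Q Q' s t + X))
      (∫ t in (0 : ℝ)..a,
        (2 * Λ.form (conjExp (t • X) (conjExp (s • Q t) (oppBracket (Q t) (Q' t))))
          (variationField X Q Q' s t + X) +
        2 * Λ.form (conjExp (t • X) (conjExp (s • Q t) (Q' t)))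
          (conjExp (t • X) (conjExp (s • Q t) (Q' t))))) s := by
  have hV := continuous_variationField (X := X) hQ hQ'
  have hW := continuous_conjExp_smul_field (X := X) (continuous_conjExp_smul_path hQ hQ')
  have hW2 := continuous_conjExp_smul_field (X := X) (continuous_conjExp_smul_path hQ
    (B := fun t => oppBracket (Q t) (Q' t)) (continuous_oppBracket_path hQ hQ'))
  refine hasDerivAt_integral_of_continuous
    (F := fun s t => 2 * Λ.form (conjExp (t • X) (conjExp (s • Q t) (Q' t)))
        (variationField X Q Q' s t + X))
    (F' := fun s t => 2 * Λ.form (conjExp (t • X) (conjExp (s • Q t) (oppBracket (Q t) (Q' t))))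
          (variationField X Q Q' s t + X) +
        2 * Λ.form (conjExp (t • X) (conjExp (s • Q t) (Q' t)))
          (conjExp (t • X) (conjExp (s • Q t) (Q' t)))) (fun s => ?_) ?_ (fun s t => ?_) s
  · have hs : Continuous fun t : ℝ => (s, t) := by fun_prop
    exact (Λ.continuous_form (hW.comp hs) ((hV.comp hs).add continuous_const)).const_smul (2 : ℝ)
  · exact ((Λ.continuous_form hW2 (hV.add continuous_const)).const_smul (2 : ℝ)).add
      ((Λ.continuous_form hW hW).const_smul (2 : ℝ))
  · have h := (hasDerivAt_variationField (X := X) (Q := Q) (Q' := Q') s t).add_const X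
    have h' := (hasDerivAt_conjExp_smul (Q t) (Q' t) s).conjExp_right (t • X)
    refine ((Λ.hasDerivAt_form h' h).const_mul 2).congr_deriv ?_
    ring

end Smooth

/-! ### The energy formula and the value of `E''(0)`. -/

section Energy

variable (Λ : D.InvariantMetric) (X : D.𝔪) {a : ℝ} {q q' : ℝ → D.𝔲}

theorem variationField_mem_uMat (s t : ℝ) :
    variationField (mat X) (fun t => mat (q t)) (fun t => mat (q' t)) s t ∈ D.uMat :=
  conjExp_mem_uMat (D.uMat.smul_mem _ (mat_𝔪_mem_uMat X)) (dexp_mem_uMat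
    (D.uMat.smul_mem _ (D.mat_mem_uMat _)) (D.uMat.smul_mem _ (D.mat_mem_uMat _)))

theorem adPart_expDiff (s t : ℝ) :
    adPart X t (expDiff (s • mat (q t)) (s • mat (q' t))) =
      D.mPart (variationField (mat X) (fun t => mat (q t)) (fun t => mat (q' t)) s t) := by
  rw [adPart_eq, expDiff_eq_dexp]
  rfl

theorem B_adPart (s t : ℝ) :
    Λ.B (adPart X t (expDiff (s • mat (q t)) (s • mat (q' t))))
        (adPart X t (expDiff (s • mat (q t)) (s • mat (q' t))) + (2 : ℝ) • X) =
      Λ.form (variationField (mat X) (fun t => mat (q t)) (fun t => mat (q' t)) s t)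
        (variationField (mat X) (fun t => mat (q t)) (fun t => mat (q' t)) s t +
          (2 : ℝ) • mat X) := by
  have hV := variationField_mem_uMat (q := q) (q' := q') X s t
  have hX := D.uMat.smul_mem (2 : ℝ) (mat_𝔪_mem_uMat X)
  rw [adPart_expDiff, Λ.form_eq hV (add_mem hV hX), mPart_add hV hX,
    mPart_smul _ (mat_𝔪_mem_uMat X), mPart_mat]

theorem speedSq_variation_eq (ha : 0 < a) (hq : ∀ t ∈ Icc 0 a,
      HasDerivWithinAt (fun r => mat (q r)) (mat (q' t)) (Icc 0 a) t) (s : ℝ) {t : ℝ}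
    (ht : t ∈ Icc 0 a) :
    speedSq Λ (variation X q s) (Icc 0 a) t = Λ.form (mat X) (mat X) +
      Λ.form (variationField (mat X) (fun t => mat (q t)) (fun t => mat (q' t)) s t)
        (variationField (mat X) (fun t => mat (q t)) (fun t => mat (q' t)) s t +
          (2 : ℝ) • mat X) := by
  rw [speedSq_variation Λ X (uniqueDiffOn_Icc ha t ht) ht (hq t ht) s]
  change Λ.form (variationField (mat X) (fun t => mat (q t)) (fun t => mat (q' t)) s t + mat X)
    (variationField (mat X) (fun t => mat (q t)) (fun t => mat (q' t)) s t + mat X) = _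
  simp only [map_add, add_apply, map_smul, smul_eq_mul]
  rw [Λ.form_comm (mat X)]
  ring

/-- A path on `[0, a]`, extended by constants. -/
def extendPath (ha : 0 ≤ a) (q : ℝ → D.𝔲) (t : ℝ) : D.𝔲 := q (projIcc 0 a ha t)

theorem extendPath_eq (ha : 0 ≤ a) (q : ℝ → D.𝔲) {t : ℝ} (ht : t ∈ Icc 0 a) :
    extendPath ha q t = q t := by
  rw [extendPath, projIcc_of_mem ha ht]

theorem continuous_extendPath (ha : 0 ≤ a) (hq : ContinuousOn (fun t => mat (q t)) (Icc 0 a)) :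
    Continuous fun t => mat (extendPath ha q t) :=
  (continuousOn_iff_continuous_domRestrict.1 hq).comp continuous_projIcc

theorem continuousOn_path (hq : ∀ t ∈ Icc 0 a,
      HasDerivWithinAt (fun r => mat (q r)) (mat (q' t)) (Icc 0 a) t) :
    ContinuousOn (fun t => mat (q t)) (Icc 0 a) :=
  fun t ht => (hq t ht).continuousWithinAt

theorem energy_variation (ha : 0 < a) (hq : ∀ t ∈ Icc 0 a,
      HasDerivWithinAt (fun r => mat (q r)) (mat (q' t)) (Icc 0 a) t)
    (hq' : ContinuousOn (fun t => mat (q' t)) (Icc 0 a)) (s : ℝ) :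
    IntervalIntegrable (speedSq Λ (variation X q s) (Icc 0 a)) MeasureTheory.volume 0 a ∧
    energy Λ a (variation X q s) = energy Λ a (orbitCurve X) +
      ∫ t in (0 : ℝ)..a,
        Λ.form (variationField (mat X) (fun t => mat (extendPath ha.le q t))
            (fun t => mat (extendPath ha.le q' t)) s t)
          (variationField (mat X) (fun t => mat (extendPath ha.le q t))
            (fun t => mat (extendPath ha.le q' t)) s t + (2 : ℝ) • mat X) := by
  -- Constant extension gives continuity on all of `ℝ` without altering integrals over `[0,a]`. The
  -- extension of `q'` need not be the derivative of that of `q`: the derivative in `t` is used only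
  -- for the speed, on `[0,a]`.
  have hQ := continuous_extendPath ha.le (continuousOn_path hq)
  have hQ' := continuous_extendPath ha.le hq'
  have hu : uIcc 0 a = Icc 0 a := uIcc_of_le ha.le
  have hspeed : ∀ s, ∀ t ∈ uIcc 0 a, speedSq Λ (variation X q s) (Icc 0 a) t =
      Λ.form (mat X) (mat X) +
        Λ.form (variationField (mat X) (fun t => mat (extendPath ha.le q t))
            (fun t => mat (extendPath ha.le q' t)) s t)
          (variationField (mat X) (fun t => mat (extendPath ha.le q t))
            (fun t => mat (extendPath ha.le q' t)) s t + (2 : ℝ) • mat X) := by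
    intro s t ht
    rw [hu] at ht
    rw [speedSq_variation_eq Λ X ha hq s ht]
    simp only [variationField, extendPath_eq ha.le _ ht]
  have hcont : ∀ s, Continuous fun t =>
      Λ.form (variationField (mat X) (fun t => mat (extendPath ha.le q t))
            (fun t => mat (extendPath ha.le q' t)) s t)
          (variationField (mat X) (fun t => mat (extendPath ha.le q t))
            (fun t => mat (extendPath ha.le q' t)) s t + (2 : ℝ) • mat X) := by
    intro s
    have hV := (continuous_variationField (X := mat X) hQ hQ').comp
      (by fun_prop : Continuous fun t : ℝ => (s, t))
    exact Λ.continuous_form hV (hV.add continuous_const)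
  have henergy : ∀ s, energy Λ a (variation X q s) = (a - 0) • Λ.form (mat X) (mat X) +
      ∫ t in (0 : ℝ)..a,
        Λ.form (variationField (mat X) (fun t => mat (extendPath ha.le q t))
            (fun t => mat (extendPath ha.le q' t)) s t)
          (variationField (mat X) (fun t => mat (extendPath ha.le q t))
            (fun t => mat (extendPath ha.le q' t)) s t + (2 : ℝ) • mat X) := by
    intro s
    rw [energy, intervalIntegral.integral_congr (hspeed s), intervalIntegral.integral_add
      (continuous_const.intervalIntegrable _ _) ((hcont s).intervalIntegrable _ _),
      intervalIntegral.integral_const]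
  constructor
  · refine (((continuous_const (y := Λ.form (mat X) (mat X))).add (hcont s)).intervalIntegrable 0 a).congr fun t ht => ?_
    exact (hspeed s t (uIoc_subset_uIcc ht)).symm
  -- `E(γ)` is the case `s = 0`, where the correction integral vanishes because `V_0 = 0`.
  · rw [henergy s, ← variation_zero X q, henergy 0]
    simp

theorem second_variation_eq {Λ : D.InvariantMetric} {X : D.𝔪} (ha : 0 < a)
    (hgeo : IsGeodesicVector Λ X)
    (hQ : Continuous fun t => mat (extendPath ha.le q t))
    (hQ' : Continuous fun t => mat (extendPath ha.le q' t)) :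
    ∫ t in (0 : ℝ)..a,
        (2 * Λ.form (conjExp (t • mat X) (conjExp ((0 : ℝ) • mat (extendPath ha.le q t))
            (oppBracket (mat (extendPath ha.le q t)) (mat (extendPath ha.le q' t)))))
          (variationField (mat X) (fun t => mat (extendPath ha.le q t))
            (fun t => mat (extendPath ha.le q' t)) 0 t + mat X) +
        2 * Λ.form (conjExp (t • mat X) (conjExp ((0 : ℝ) • mat (extendPath ha.le q t))
            (mat (extendPath ha.le q' t))))
          (conjExp (t • mat X) (conjExp ((0 : ℝ) • mat (extendPath ha.le q t))
            (mat (extendPath ha.le q' t))))) =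
      2 * (∫ t in (0 : ℝ)..a, Λ.B (D.mPart (rightBracket (mat (q t)) (mat (q' t)))) X) +
        2 * (∫ t in (0 : ℝ)..a, Λ.B (adPart X t (mat (q' t))) (adPart X t (mat (q' t)))) := by
  have hu : uIcc 0 a = Icc 0 a := uIcc_of_le ha.le
  have hX := mat_𝔪_mem_uMat X
  have hbr : ∀ t, oppBracket (mat (extendPath ha.le q t)) (mat (extendPath ha.le q' t)) ∈ D.uMat :=
    fun t => D.oppBracket_mem_uMat _ (D.mat_mem_uMat _) _ (D.mat_mem_uMat _)
  have hconj := (continuous_conjExp_smul_field (X := mat X) (hQ'.comp continuous_snd)).comp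
    (by fun_prop : Continuous fun t : ℝ => ((0 : ℝ), t))
  -- At `s = 0` the inner conjugations and `V_0` disappear; the geodesic property then removes
  -- `Ad(exp(-tX))` from the bracket term, but not from the quadratic one.
  simp only [zero_smul, conjExp_zero_left, variationField_zero, zero_add,
    hgeo.form_conjExp (hbr _)]
  rw [intervalIntegral.integral_add, intervalIntegral.integral_const_mul,
    intervalIntegral.integral_const_mul]
  · congr 2
    · refine intervalIntegral.integral_congr fun t ht => ?_
      rw [hu] at ht
      simp only [Λ.form_eq (hbr t) hX, mPart_mat]
      simp only [extendPath_eq ha.le _ ht, rightBracket_eq_oppBracket]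
    · refine intervalIntegral.integral_congr fun t ht => ?_
      rw [hu] at ht
      have hW : conjExp (t • mat X) (mat (q' t)) ∈ D.uMat :=
        conjExp_mem_uMat (D.uMat.smul_mem _ hX) (D.mat_mem_uMat _)
      simp only [adPart_eq, extendPath_eq ha.le _ ht, Λ.form_eq hW hW]
  · exact ((Λ.continuous_form (continuous_oppBracket_path hQ hQ')
      continuous_const).const_smul (2 : ℝ)).intervalIntegrable _ _
  · exact ((Λ.continuous_form hconj hconj).const_smul (2 : ℝ)).intervalIntegrable _ _

end Energy

end Datum

end FlagManifold

end

open FlagManifold FlagManifold.Datum in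
theorem proposition2p7 {n : Type*} [Fintype n] [DecidableEq n] (D : FlagManifold.Datum n)
    (Λ : D.InvariantMetric) (X : D.𝔪) (a : ℝ) (ha : 0 < a) (q q' : ℝ → D.𝔲)
    (hq : ∀ t ∈ Set.Icc 0 a,
      HasDerivWithinAt (fun r => mat (q r)) (mat (q' t)) (Set.Icc 0 a) t)
    (hq' : ContinuousOn (fun t => mat (q' t)) (Set.Icc 0 a)) :
    (∀ s : ℝ,
      IntervalIntegrable (speedSq Λ (variation X q s) (Set.Icc 0 a)) MeasureTheory.volume 0 a ∧
      energy Λ a (variation X q s) = energy Λ a (orbitCurve X) +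
        ∫ t in (0 : ℝ)..a,
          Λ.B (adPart X t (expDiff (s • mat (q t)) (s • mat (q' t))))
            (adPart X t (expDiff (s • mat (q t)) (s • mat (q' t))) + (2 : ℝ) • X)) ∧
    (IsGeodesicVector Λ X →
      (∀ᶠ s in nhds (0 : ℝ),
        DifferentiableAt ℝ (fun σ : ℝ => energy Λ a (variation X q σ)) s) ∧
      HasDerivAt (deriv (fun σ : ℝ => energy Λ a (variation X q σ)))
        (2 * (∫ t in (0 : ℝ)..a, Λ.B (D.mPart (rightBracket (mat (q t)) (mat (q' t)))) X) +
          2 * (∫ t in (0 : ℝ)..a, Λ.B (adPart X t (mat (q' t))) (adPart X t (mat (q' t)))))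
        0) := by
  have hu : Set.uIcc 0 a = Set.Icc 0 a := Set.uIcc_of_le ha.le
  have hE := energy_variation Λ X ha hq hq'
  have hQ := continuous_extendPath ha.le (continuousOn_path hq)
  have hQ' := continuous_extendPath ha.le hq'
  refine ⟨fun s => ⟨(hE s).1, (hE s).2.trans ?_⟩, fun hgeo => ?_⟩
  · congr 1
    refine intervalIntegral.integral_congr fun t ht => ?_
    rw [hu] at ht
    simp only [B_adPart Λ X, variationField, extendPath_eq ha.le _ ht]
  · have hfun : (fun σ : ℝ => energy Λ a (variation X q σ)) = _ := funext fun s => (hE s).2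
    have h1 := fun s => (hasDerivAt_integral_form (X := mat X) Λ hQ hQ' a s).const_add
      (energy Λ a (orbitCurve X))
    rw [hfun]
    refine ⟨Filter.Eventually.of_forall fun s => (h1 s).differentiableAt, ?_⟩
    rw [funext fun s => (h1 s).deriv]
    refine (hasDerivAt_integral_form_deriv (X := mat X) Λ hQ hQ' a 0).congr_deriv ?_
    exact second_variation_eq ha hgeo hQ hQ'
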